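/- Let $Q$ be a connected, paracompact, Hausdorff $C^{r+1}$ manifold (without boundary) of finite dimension $d$, $r\ge 2$, and let $T\subseteq\mathbb{R}$ be a nonempty open interval. For $t\in T$ let $a_t$ be a Riemannian metric, $b_t$ a 1-form and $V(t,\cdot)$ a real function on $Q$, all of class $C^r$ jointly in $(t,q)\in T\times Q$. Consider the Lagrangian $$L(t,q,v)=\tfrac12 a_t(v,v)+b_t(v)-V(t,q),$$ and the spacetime $M=T\times Q\times\mathbb{R}$ with coordinates $(t,q,y)$ and Lorentzian metric $$g=a_t-dt\otimes(dy-b_t)-(dy-b_t)\otimes dt-2V\,dt^2 .$$ The Euler–Lagrange flow is called complete if every $C^2$ solution $q:J\to Q$ of the Euler–Lagrange equation of $L$ on a nonempty open interval $J\subseteq T$ extends to a solution on all of $\mathbb{R}$ (in particular, this requires $T=\mathbb{R}$). A (semi-)Riemannian manifold is called geodesically complete (resp. null, causally geodesically complete) if every affinely parametrized geodesic (resp. every geodesic with nonzero velocity $\gamma'$ satisfying $g(\gamma',\gamma')=0$, resp. $g(\gamma',\gamma')\le 0$) on a nonempty open interval extends to a geodesic on all of $\mathbb{R}$. Then: 1.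 The Euler–Lagrange flow is complete if and only if $(M,g)$ is null geodesically complete, and in this case $(M,g)$ is causally geodesically complete. 2. The Euler–Lagrange flow is complete and the Riemannian manifolds $(Q,a_t)$ are geodesically complete for all $t\in T$ if and only if $(M,g)$ is geodesically complete. -/

import Mathlib

open scoped Manifold ContDiff Topology
open Set

noncomputable section

/-! ### Geodesics of a (pseudo-)Riemannian metric -/

section Geodesics

variable {E : Type*} [NormedAddCommGroup E] [NormedSpace ℝ E]
  {H : Type*} [TopologicalSpace H] (I : ModelWithCorners ℝ E H)
  {M : Type*} [TopologicalSpace M] [ChartedSpace H M]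

/-- A field of bilinear forms on the tangent spaces of `M`, i.e. a covariant tensor field of
order two. -/
abbrev BilinField : Type _ :=
  (x : M) → LinearMap.BilinForm ℝ (TangentSpace I x)

variable {I}

/-- The components of `g` in the chart of `M` around `x₀`, at the point of `M` with coordinates
`z`: the vectors `u v` of the model space are pushed forward by the inverse of the chart. -/
def chartComp (g : BilinField I (M := M)) (x₀ : M) (z u v : E) : ℝ :=
  g ((extChartAt I x₀).symm z)
    (mfderiv 𝓘(ℝ, E) I (extChartAt I x₀).symm z u)
    (mfderiv 𝓘(ℝ, E) I (extChartAt I x₀).symm z v)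

/-- The Christoffel symbols of the first kind of `g`, in the chart around `x₀`:
`Γ(u, v; w) = (∂_u g(v, w) + ∂_v g(u, w) - ∂_w g(u, v)) / 2` for constant vectors `u v w`. -/
def christoffelFirst (g : BilinField I (M := M)) (x₀ : M) (z u v w : E) : ℝ :=
  (fderiv ℝ (fun x => chartComp g x₀ x v w) z u
    + fderiv ℝ (fun x => chartComp g x₀ x u w) z v
    - fderiv ℝ (fun x => chartComp g x₀ x u v) z w) / 2

/-- `γ` is an (affinely parametrized) geodesic of the metric `g` on the open set `J` of
parameters: it is `C^2` and satisfies `∇_{γ'} γ' = 0`, which is written, at each parameter `s₀`,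
in the chart around `γ s₀` and with the free index lowered by the (nondegenerate) metric:
`g(c'', w) + Γ(c', c'; w) = 0` for all `w`, where `c` is the curve in coordinates. -/
def IsGeodesicOn (g : BilinField I (M := M)) (γ : ℝ → M) (J : Set ℝ) : Prop :=
  ContMDiffOn 𝓘(ℝ, ℝ) I 2 γ J ∧
  ∀ s₀ ∈ J, ∀ w : E,
    let c : ℝ → E := fun s => extChartAt I (γ s₀) (γ s)
    chartComp g (γ s₀) (c s₀) (deriv (deriv c) s₀) w
      + christoffelFirst g (γ s₀) (c s₀) (deriv c s₀) (deriv c s₀) w = 0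

variable (I) in
/-- The velocity of a curve in `M`. -/
def velocity (γ : ℝ → M) (s : ℝ) : TangentSpace I (γ s) :=
  mfderiv 𝓘(ℝ, ℝ) I γ s (1 : ℝ)

/-- The curve `γ` is causal on `J`: its velocity is a nonzero vector that is timelike or
lightlike. -/
def IsCausalOn (g : BilinField I (M := M)) (γ : ℝ → M) (J : Set ℝ) : Prop :=
  ∀ s ∈ J, velocity I γ s ≠ 0 ∧ g (γ s) (velocity I γ s) (velocity I γ s) ≤ 0

/-- The curve `γ` is lightlike (null) on `J`. -/
def IsNullOn (g : BilinField I (M := M)) (γ : ℝ → M) (J : Set ℝ) : Prop :=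
  ∀ s ∈ J, velocity I γ s ≠ 0 ∧ g (γ s) (velocity I γ s) (velocity I γ s) = 0

/-- Every geodesic on an open interval extends to a geodesic on the whole real line. -/
def GeodesicallyComplete (g : BilinField I (M := M)) : Prop :=
  ∀ (J : Set ℝ) (γ : ℝ → M), IsOpen J → J.OrdConnected → J.Nonempty →
    IsGeodesicOn g γ J →
    ∃ γ' : ℝ → M, IsGeodesicOn g γ' univ ∧ EqOn γ' γ J

/-- Every causal geodesic on an open interval extends to a geodesic on the whole real line. -/
def CausallyGeodesicallyComplete (g : BilinField I (M := M)) : Prop :=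
  ∀ (J : Set ℝ) (γ : ℝ → M), IsOpen J → J.OrdConnected → J.Nonempty →
    IsGeodesicOn g γ J → IsCausalOn g γ J →
    ∃ γ' : ℝ → M, IsGeodesicOn g γ' univ ∧ EqOn γ' γ J

/-- Every lightlike geodesic on an open interval extends to a geodesic on the whole real line. -/
def NullGeodesicallyComplete (g : BilinField I (M := M)) : Prop :=
  ∀ (J : Set ℝ) (γ : ℝ → M), IsOpen J → J.OrdConnected → J.Nonempty →
    IsGeodesicOn g γ J → IsNullOn g γ J →
    ∃ γ' : ℝ → M, IsGeodesicOn g γ' univ ∧ EqOn γ' γ J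

end Geodesics

/-! ### Time dependent mechanical systems and their Eisenhart spacetimes -/

section Mechanics

variable {d : ℕ} {Q : Type*} [TopologicalSpace Q] [ChartedSpace (EuclideanSpace ℝ (Fin d)) Q]
  {r : WithTop ℕ∞}

variable (d Q r) in
/-- The data of the Lagrangian `a_t(v, v) / 2 + b_t(v) - V(t, q)` on the `d`-dimensional
manifold `Q`: an open time interval `T` and, for `t ∈ T`, a Riemannian metric `a t`, a one-form
`b t` and a function `V t` on `Q`, all of class `C^r` jointly in `(t, q)`. The values of the
fields at times outside `T` are irrelevant. -/
structure MechanicalSystem where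
  T : TopologicalSpace.Opens ℝ
  T_nonempty : (T : Set ℝ).Nonempty
  T_ordConnected : (T : Set ℝ).OrdConnected
  a : ℝ → BilinField (𝓡 d) (M := Q)
  b : ℝ → (q : Q) → TangentSpace (𝓡 d) q →L[ℝ] ℝ
  V : ℝ → Q → ℝ
  a_symm : ∀ t ∈ T, ∀ (q : Q) (u v : TangentSpace (𝓡 d) q), a t q u v = a t q v u
  a_pos : ∀ t ∈ T, ∀ (q : Q) (v : TangentSpace (𝓡 d) q), v ≠ 0 → 0 < a t q v v
  /-- In the charts of `Q`, the components of `a` are of class `C^r`. -/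
  a_smooth : ∀ (q₀ : Q) (u v : EuclideanSpace ℝ (Fin d)),
    ContDiffOn ℝ r (fun p : ℝ × EuclideanSpace ℝ (Fin d) => chartComp (a p.1) q₀ p.2 u v)
      ((T : Set ℝ) ×ˢ (extChartAt (𝓡 d) q₀).target)
  /-- In the charts of `Q`, the components of `b` are of class `C^r`. -/
  b_smooth : ∀ (q₀ : Q) (v : EuclideanSpace ℝ (Fin d)),
    ContDiffOn ℝ r (fun p : ℝ × EuclideanSpace ℝ (Fin d) =>
        b p.1 ((extChartAt (𝓡 d) q₀).symm p.2)
          (mfderiv 𝓘(ℝ, EuclideanSpace ℝ (Fin d)) (𝓡 d) (extChartAt (𝓡 d) q₀).symm p.2 v))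
      ((T : Set ℝ) ×ˢ (extChartAt (𝓡 d) q₀).target)
  /-- In the charts of `Q`, the function `V` is of class `C^r`. -/
  V_smooth : ∀ q₀ : Q,
    ContDiffOn ℝ r (fun p : ℝ × EuclideanSpace ℝ (Fin d) =>
        V p.1 ((extChartAt (𝓡 d) q₀).symm p.2))
      ((T : Set ℝ) ×ˢ (extChartAt (𝓡 d) q₀).target)

namespace MechanicalSystem

variable (S : MechanicalSystem d Q r)

/-- The Lagrangian `L(t, q, v) = a_t(v, v) / 2 + b_t(v) - V(t, q)`. -/
def lagrangian (t : ℝ) (q : Q) (v : TangentSpace (𝓡 d) q) : ℝ :=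
  S.a t q v v / 2 + S.b t q v - S.V t q

/-- The Lagrangian in the chart of `Q` around `q₀`, as a function of time, coordinates and
coordinate velocity. -/
def chartLagrangian (q₀ : Q) (t : ℝ) (x v : EuclideanSpace ℝ (Fin d)) : ℝ :=
  S.lagrangian t ((extChartAt (𝓡 d) q₀).symm x)
    (mfderiv 𝓘(ℝ, EuclideanSpace ℝ (Fin d)) (𝓡 d) (extChartAt (𝓡 d) q₀).symm x v)

/-- `q` is a solution, on the open set `J` of times, of the Euler-Lagrange equation
`d/dt (∂L/∂v) = ∂L/∂q`, which is written at each time `t₀` in the chart around `q t₀`. -/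
def IsELSolutionOn (q : ℝ → Q) (J : Set ℝ) : Prop :=
  J ⊆ (S.T : Set ℝ) ∧
  ContMDiffOn 𝓘(ℝ, ℝ) (𝓡 d) 2 q J ∧
  ∀ t₀ ∈ J, ∀ w : EuclideanSpace ℝ (Fin d),
    let c : ℝ → EuclideanSpace ℝ (Fin d) := fun t => extChartAt (𝓡 d) (q t₀) (q t)
    deriv (fun t => fderiv ℝ (fun v => S.chartLagrangian (q t₀) t (c t) v) (deriv c t) w) t₀
      = fderiv ℝ (fun x => S.chartLagrangian (q t₀) t₀ x (deriv c t₀)) (c t₀) w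

/-- The Euler-Lagrange flow is complete: every local solution of the Euler-Lagrange equation
extends to a solution that is defined at all real times. -/
def ELFlowComplete : Prop :=
  ∀ (J : Set ℝ) (q : ℝ → Q), IsOpen J → J.OrdConnected → J.Nonempty →
    S.IsELSolutionOn q J →
    ∃ q' : ℝ → Q, S.IsELSolutionOn q' univ ∧ EqOn q' q J

/-- The manifold `M = T × Q × ℝ`, with coordinates `(t, q, y)`. -/
abbrev Spacetime : Type _ := S.T × Q × ℝ

variable (d) in
/-- The model with corners (without boundary) of the spacetime `T × Q × ℝ`. -/
abbrev spacetimeModel : ModelWithCorners ℝ (ℝ × EuclideanSpace ℝ (Fin d) × ℝ)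
    (ModelProd ℝ (ModelProd (EuclideanSpace ℝ (Fin d)) ℝ)) :=
  𝓘(ℝ, ℝ).prod ((𝓡 d).prod 𝓘(ℝ, ℝ))

/-- The one-form `dt` on the spacetime. -/
def dt (x : S.Spacetime) : TangentSpace (spacetimeModel d) x →L[ℝ] ℝ :=
  mfderiv (spacetimeModel d) 𝓘(ℝ, ℝ) (fun p : S.Spacetime => (p.1 : ℝ)) x

/-- The one-form `dy` on the spacetime. -/
def dy (x : S.Spacetime) : TangentSpace (spacetimeModel d) x →L[ℝ] ℝ :=
  mfderiv (spacetimeModel d) 𝓘(ℝ, ℝ) (fun p : S.Spacetime => p.2.2) x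

/-- The differential of the projection of the spacetime onto `Q`. -/
def dq (x : S.Spacetime) : TangentSpace (spacetimeModel d) x →L[ℝ] TangentSpace (𝓡 d) x.2.1 :=
  mfderiv (spacetimeModel d) (𝓡 d) (fun p : S.Spacetime => p.2.1) x

/-- The one-form `dy - b_t` on the spacetime. -/
def dyb (x : S.Spacetime) : TangentSpace (spacetimeModel d) x →L[ℝ] ℝ :=
  S.dy x - (S.b x.1 x.2.1).comp (S.dq x)

/-- The Eisenhart (Brinkmann) metric
`g = a_t - dt ⊗ (dy - b_t) - (dy - b_t) ⊗ dt - 2 V dt ⊗ dt`. -/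
def eisenhartMetric : BilinField (spacetimeModel d) (M := S.Spacetime) := fun x =>
  LinearMap.mk₂ ℝ
    (fun u v => S.a x.1 x.2.1 (S.dq x u) (S.dq x v)
      - S.dt x u * S.dyb x v - S.dyb x u * S.dt x v
      - 2 * S.V x.1 x.2.1 * (S.dt x u * S.dt x v))
    (fun u u' v => by simp only [map_add, LinearMap.add_apply]; ring)
    (fun c u v => by simp only [map_smul, LinearMap.smul_apply, smul_eq_mul]; ring)
    (fun u v v' => by simp only [map_add]; ring)
    (fun c u v => by simp only [map_smul, smul_eq_mul]; ring)

end MechanicalSystem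

end Mechanics

end

/-!
For a number `k` let `L_k(t, q, v) = a_t(v, v) / 2 + k b_t(v) - k² V(t, q)`, so that `L = L_1` and
`L_k(t, q, v) = k² L(t, q, v / k)` for `k ≠ 0`. Along a curve `(t, q, y)` of the spacetime with
`t' = k` one has `g(γ', γ') / 2 = L_k(t, q, q') - k y'`, and this energy yields the geodesic
equation: its `y`-component is `t'' = 0`, hence `t = k s + c`; its `q`-component is the
Euler-Lagrange equation of `L_k` along `t = k s + c`; its `t`-component
`y'' = d/ds (∂L_k/∂k) - ∂L_k/∂t` is solved by two quadratures. So a geodesic extends as soon as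
its projection to `Q` does. For `k ≠ 0` that projection is an affinely reparametrized solution of
the Euler-Lagrange equation of `L`; for `k = 0` it is a geodesic of `a_c`, and it is constant if
the geodesic is causal, because then `a_c(q', q') ≤ 0`. Conversely, a solution `q` of the
Euler-Lagrange equation lifts to a geodesic with `t = s` and any initial value of `y'`; the choice
`y' = L` at one time makes the lift null, because `g(γ', γ')` is constant.
-/

noncomputable section

section Interval

variable {E : Type*} [NormedAddCommGroup E] [NormedSpace ℝ E] {J : Set ℝ} {s₀ : ℝ}

theorem hasDerivAt_mul_add_const (k c s : ℝ) : HasDerivAt (fun s => k * s + c) k s := by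
  simpa using ((hasDerivAt_id s).const_mul k).add_const c

theorem deriv_comp_mul_add_const (f : ℝ → E) (m n : ℝ) :
    deriv (fun s => f (m * s + n)) = fun s => m • deriv f (m * s + n) := by
  funext s
  rw [deriv_comp_mul_left m (fun s => f (s + n)), deriv_comp_add_const]

theorem ordConnected_preimage_mul_add_const (hJc : J.OrdConnected) (m n : ℝ) :
    ((fun s => m * s + n) ⁻¹' J).OrdConnected := by
  rcases le_total 0 m with hm | hm
  · exact hJc.preimage_mono fun s t h => by simpa using mul_le_mul_of_nonneg_left h hm
  · exact hJc.preimage_anti fun s t h => by simpa using mul_le_mul_of_nonpos_left h hm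

theorem coeff_eq_of_eqOn_mul_add_const (hJ : IsOpen J) (hs₀ : s₀ ∈ J) {k c k' c' : ℝ}
    (h : EqOn (fun s => k * s + c) (fun s => k' * s + c') J) : k = k' ∧ c = c' := by
  obtain rfl : k = k' := by
    simpa only [(hasDerivAt_mul_add_const _ _ s₀).deriv] using
      (h.eventuallyEq_of_mem (hJ.mem_nhds hs₀)).deriv_eq
  exact ⟨rfl, add_left_cancel (h hs₀)⟩

theorem exists_hasDerivAt_of_continuousOn [CompleteSpace E] (hJ : IsOpen J)
    (hJc : J.OrdConnected) (hs₀ : s₀ ∈ J) {f : ℝ → E} (hf : ContinuousOn f J) (y₀ : E) :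
    ∃ F : ℝ → E, F s₀ = y₀ ∧ ∀ s ∈ J, HasDerivAt F (f s) s := by
  refine ⟨fun u => y₀ + ∫ x in s₀..u, f x, by simp, fun s hs => HasDerivAt.const_add y₀ ?_⟩
  exact intervalIntegral.integral_hasDerivAt_right
    (hf.mono (hJc.uIcc_subset hs₀ hs)).intervalIntegrable
    (hf.stronglyMeasurableAtFilter hJ s hs) (hf.continuousAt (hJ.mem_nhds hs))

theorem exists_deriv_deriv_eq [CompleteSpace E] (hJ : IsOpen J) (hJc : J.OrdConnected)
    (hs₀ : s₀ ∈ J) {f : ℝ → E} (hf : ContinuousOn f J) (y₀ y₁ : E) :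
    ∃ y : ℝ → E, ContDiffOn ℝ 2 y J ∧ EqOn (deriv (deriv y)) f J ∧ y s₀ = y₀ ∧
      deriv y s₀ = y₁ := by
  obtain ⟨h, h₀, hh⟩ := exists_hasDerivAt_of_continuousOn hJ hJc hs₀ hf y₁
  obtain ⟨y, hy₀, hy⟩ := exists_hasDerivAt_of_continuousOn hJ hJc hs₀
    (fun s hs => (hh s hs).continuousAt.continuousWithinAt) y₀
  have hdy : EqOn (deriv y) h J := fun s hs => (hy s hs).deriv
  have hddy : EqOn (deriv (deriv y)) f J := fun s hs =>
    ((hdy.eventuallyEq_of_mem (hJ.mem_nhds hs)).deriv_eq).trans (hh s hs).deriv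
  have hdiff : DifferentiableOn ℝ y J := fun s hs =>
    (hy s hs).differentiableAt.differentiableWithinAt
  have hdiff' : DifferentiableOn ℝ (deriv y) J := fun s hs =>
    ((hh s hs).differentiableAt.congr_of_eventuallyEq
      (hdy.eventuallyEq_of_mem (hJ.mem_nhds hs))).differentiableWithinAt
  have hC1 : ContDiffOn ℝ 1 (deriv y) J := (contDiffOn_succ_iff_deriv_of_isOpen (n := 0) hJ).2
    ⟨hdiff', by simp, contDiffOn_zero.2 (hf.congr hddy)⟩
  exact ⟨y, (contDiffOn_succ_iff_deriv_of_isOpen (n := 1) hJ).2 ⟨hdiff, by simp, hC1⟩, hddy, hy₀,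
    (hdy hs₀).trans h₀⟩

theorem eqOn_of_deriv_deriv_eq (hJ : IsOpen J) (hJc : J.OrdConnected) (hs₀ : s₀ ∈ J)
    {y z : ℝ → E} (hy : ContDiffOn ℝ 2 y J) (hz : ContDiffOn ℝ 2 z J)
    (h : EqOn (deriv (deriv y)) (deriv (deriv z)) J) (h₀ : y s₀ = z s₀)
    (h₁ : deriv y s₀ = deriv z s₀) : EqOn y z J := by
  have hderiv : ∀ {y : ℝ → E}, ContDiffOn ℝ 2 y J → DifferentiableOn ℝ (deriv y) J := fun hy =>
    ((contDiffOn_succ_iff_deriv_of_isOpen (n := 1) hJ).1 hy).2.2.differentiableOn one_ne_zero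
  exact hJ.eqOn_of_deriv_eq hJc.isPreconnected (hy.differentiableOn two_ne_zero)
    (hz.differentiableOn two_ne_zero)
    (hJ.eqOn_of_deriv_eq hJc.isPreconnected (hderiv hy) (hderiv hz) h hs₀ h₁) hs₀ h₀

theorem exists_eqOn_mul_add_const (hJ : IsOpen J) (hJc : J.OrdConnected) (hs₀ : s₀ ∈ J)
    {y : ℝ → ℝ} (hy : ContDiffOn ℝ 2 y J) (h : ∀ s ∈ J, deriv (deriv y) s = 0) :
    ∃ k c : ℝ, EqOn y (fun s => k * s + c) J := by
  have hd : ∀ k c : ℝ, deriv (fun s => k * s + c) = fun _ => k := fun k c =>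
    funext fun s => (hasDerivAt_mul_add_const k c s).deriv
  refine ⟨deriv y s₀, y s₀ - deriv y s₀ * s₀, eqOn_of_deriv_deriv_eq hJ hJc hs₀ hy (by fun_prop)
    (fun s hs => ?_) (by ring) (by rw [hd])⟩
  rw [h s hs, hd, deriv_const]

end Interval

section Calculus

variable {E F G : Type*} [NormedAddCommGroup E] [NormedSpace ℝ E] [NormedAddCommGroup F]
  [NormedSpace ℝ F] [NormedAddCommGroup G] [NormedSpace ℝ G]

theorem hasDerivAt_clm_apply_comp {B : F → E →L[ℝ] G} {p : ℝ → F} {u : ℝ → E} {s : ℝ} {p' : F}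
    {u' : E} (hB : DifferentiableAt ℝ B (p s)) (hp : HasDerivAt p p' s) (hu : HasDerivAt u u' s) :
    HasDerivAt (fun s => B (p s) (u s)) (fderiv ℝ B (p s) p' (u s) + B (p s) u') s :=
  (hB.hasFDerivAt.comp_hasDerivAt (f := p) s hp).clm_apply hu

theorem hasDerivAt_clm_apply₂_comp {A : F → E →L[ℝ] E →L[ℝ] G} {p : ℝ → F} {u v : ℝ → E} {s : ℝ}
    {p' : F} {u' v' : E} (hA : DifferentiableAt ℝ A (p s)) (hp : HasDerivAt p p' s)
    (hu : HasDerivAt u u' s) (hv : HasDerivAt v v' s) :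
    HasDerivAt (fun s => A (p s) (u s) (v s))
      (fderiv ℝ A (p s) p' (u s) (v s) + A (p s) u' (v s) + A (p s) (u s) v') s :=
  (hasDerivAt_clm_apply_comp hA hp hu).clm_apply hv

theorem hasFDerivAt_clm_apply_const {B : F → E →L[ℝ] G} {x : F} (hB : DifferentiableAt ℝ B x)
    (u : E) : HasFDerivAt (fun x => B x u) ((fderiv ℝ B x).flip u) x := by
  simpa using hB.hasFDerivAt.clm_apply (hasFDerivAt_const u x)

theorem hasFDerivAt_clm_apply₂_const {A : F → E →L[ℝ] E →L[ℝ] G} {x : F}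
    (hA : DifferentiableAt ℝ A x) (u v : E) :
    HasFDerivAt (fun x => A x u v) (((fderiv ℝ A x).flip u).flip v) x := by
  have hAu : HasFDerivAt (fun x => A x u) ((fderiv ℝ A x).flip u) x :=
    hasFDerivAt_clm_apply_const hA u
  simpa using hAu.clm_apply (hasFDerivAt_const v x)

theorem eventually_deriv_prodMk {f : ℝ → E} {g : ℝ → F} {s : ℝ} (hf : ContDiffAt ℝ 2 f s)
    (hg : ContDiffAt ℝ 2 g s) :
    deriv (fun s => (f s, g s)) =ᶠ[𝓝 s] fun s => (deriv f s, deriv g s) := by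
  filter_upwards [hf.eventually (by simp), hg.eventually (by simp)] with s hf hg
  exact ((hf.differentiableAt two_ne_zero).hasDerivAt.prodMk
    (hg.differentiableAt two_ne_zero).hasDerivAt).deriv

theorem deriv_deriv_prodMk {f : ℝ → E} {g : ℝ → F} {s : ℝ} (hf : ContDiffAt ℝ 2 f s)
    (hg : ContDiffAt ℝ 2 g s) :
    deriv (deriv fun s => (f s, g s)) s = (deriv (deriv f) s, deriv (deriv g) s) := by
  have hf' : ContDiffAt ℝ 1 (deriv f) s := hf.derivWithin (m := 1) (by norm_num)
  have hg' : ContDiffAt ℝ 1 (deriv g) s := hg.derivWithin (m := 1) (by norm_num)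
  rw [(eventually_deriv_prodMk hf hg).deriv_eq]
  exact ((hf'.differentiableAt one_ne_zero).hasDerivAt.prodMk
    (hg'.differentiableAt one_ne_zero).hasDerivAt).deriv

end Calculus

section Curves

variable {E : Type*} [NormedAddCommGroup E] [NormedSpace ℝ E] {H : Type*} [TopologicalSpace H]
  {I : ModelWithCorners ℝ E H} {M : Type*} [TopologicalSpace M] [ChartedSpace H M]
  {γ γ' : ℝ → M} {s s₀ : ℝ}

variable (I) in
/-- The curve `γ` in the chart of `M` around `γ s₀`. -/
def coordCurve (γ : ℝ → M) (s₀ : ℝ) : ℝ → E := fun s => extChartAt I (γ s₀) (γ s)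

theorem coordCurve_self_mem_target (γ : ℝ → M) (s : ℝ) :
    coordCurve I γ s s ∈ (extChartAt I (γ s)).target :=
  mem_extChartAt_target (γ s)

theorem contDiffAt_coordCurve (hγ : ContMDiffAt 𝓘(ℝ, ℝ) I 2 γ s₀) :
    ContDiffAt ℝ 2 (coordCurve I γ s₀) s₀ :=
  (contMDiffAt_extChartAt.comp s₀ hγ).contDiffAt

theorem eventually_symm_coordCurve (hγ : ContinuousAt γ s₀) :
    ∀ᶠ s in 𝓝 s₀, (extChartAt I (γ s₀)).symm (coordCurve I γ s₀ s) = γ s :=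
  (hγ.eventually_mem (extChartAt_source_mem_nhds (I := I) (γ s₀))).mono
    fun _ h => (extChartAt I (γ s₀)).left_inv h

theorem eventually_coordCurve_mem_target (hγ : ContinuousAt γ s₀) :
    ∀ᶠ s in 𝓝 s₀, coordCurve I γ s₀ s ∈ (extChartAt I (γ s₀)).target :=
  (hγ.eventually_mem (extChartAt_source_mem_nhds (I := I) (γ s₀))).mono
    fun _ h => (extChartAt I (γ s₀)).map_source h

theorem eventually_hasDerivAt_coordCurve (hγ : ContMDiffAt 𝓘(ℝ, ℝ) I 2 γ s₀) :
    ∀ᶠ s in 𝓝 s₀, HasDerivAt (coordCurve I γ s₀) (deriv (coordCurve I γ s₀) s) s :=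
  ((contDiffAt_coordCurve hγ).eventually (by simp)).mono
    fun _ h => (h.differentiableAt two_ne_zero).hasDerivAt

theorem contDiffAt_deriv_coordCurve (hγ : ContMDiffAt 𝓘(ℝ, ℝ) I 2 γ s₀) :
    ContDiffAt ℝ 1 (deriv (coordCurve I γ s₀)) s₀ :=
  (contDiffAt_coordCurve hγ).derivWithin (m := 1) (by norm_num)

theorem hasDerivAt_deriv_coordCurve (hγ : ContMDiffAt 𝓘(ℝ, ℝ) I 2 γ s₀) :
    HasDerivAt (deriv (coordCurve I γ s₀)) (deriv (deriv (coordCurve I γ s₀)) s₀) s₀ :=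
  ((contDiffAt_deriv_coordCurve hγ).differentiableAt one_ne_zero).hasDerivAt

theorem mk_velocity_congr (h : γ =ᶠ[𝓝 s] γ') :
    (⟨γ s, velocity I γ s⟩ : TangentBundle I M) = ⟨γ' s, velocity I γ' s⟩ := by
  have hv : (velocity I γ s : E) = velocity I γ' s :=
    congrArg (fun L : ℝ →L[ℝ] E => L 1) h.mfderiv_eq
  exact Bundle.TotalSpace.ext h.eq_of_nhds (heq_of_eq hv)

theorem velocity_comp {E' : Type*} [NormedAddCommGroup E'] [NormedSpace ℝ E'] {H' : Type*}
    [TopologicalSpace H'] {I' : ModelWithCorners ℝ E' H'} {N : Type*} [TopologicalSpace N]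
    [ChartedSpace H' N] {f : M → N} (hf : MDifferentiableAt I I' f (γ s))
    (hγ : MDifferentiableAt 𝓘(ℝ, ℝ) I γ s) :
    velocity I' (f ∘ γ) s = mfderiv I I' f (γ s) (velocity I γ s) :=
  mfderiv_comp_apply s hf hγ (1 : ℝ)

theorem velocity_eq_deriv (c : ℝ → E) (s : ℝ) : velocity 𝓘(ℝ, E) c s = deriv c s :=
  congrArg (fun L : ℝ →L[ℝ] E => L 1) mfderiv_eq_fderiv

theorem mdifferentiableAt_extChartAt_symm [I.Boundaryless] [IsManifold I 1 M] {x : M} {z : E}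
    (hz : z ∈ (extChartAt I x).target) :
    MDifferentiableAt 𝓘(ℝ, E) I (extChartAt I x).symm z :=
  ((contMDiffOn_extChartAt_symm (n := 1) x).contMDiffAt
    ((isOpen_extChartAt_target x).mem_nhds hz)).mdifferentiableAt one_ne_zero

theorem eventually_mk_velocity_eq [I.Boundaryless] [IsManifold I 1 M]
    (hγ : ContMDiffAt 𝓘(ℝ, ℝ) I 2 γ s₀) :
    ∀ᶠ s in 𝓝 s₀, (⟨γ s, velocity I γ s⟩ : TangentBundle I M) =
      ⟨(extChartAt I (γ s₀)).symm (coordCurve I γ s₀ s),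
        mfderiv 𝓘(ℝ, E) I (extChartAt I (γ s₀)).symm (coordCurve I γ s₀ s)
          (deriv (coordCurve I γ s₀) s : E)⟩ := by
  filter_upwards [(eventually_symm_coordCurve (I := I) hγ.continuousAt).eventually_nhds,
    eventually_hasDerivAt_coordCurve hγ,
    eventually_coordCurve_mem_target (I := I) hγ.continuousAt] with s hsymm hderiv hmem
  have hmdiff : MDifferentiableAt 𝓘(ℝ, ℝ) 𝓘(ℝ, E) (coordCurve I γ s₀) s :=
    hderiv.differentiableAt.mdifferentiableAt
  have hv := velocity_comp (mdifferentiableAt_extChartAt_symm hmem) hmdiff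
  rw [velocity_eq_deriv] at hv
  refine (mk_velocity_congr (hsymm.mono fun _ h => h.symm)).trans ?_
  exact congrArg (Bundle.TotalSpace.mk _) hv

theorem eqOn_const_of_velocity_eq_zero [IsManifold I 1 M] {J : Set ℝ} (hJ : IsOpen J)
    (hJc : J.OrdConnected) (hγ : ContMDiffOn 𝓘(ℝ, ℝ) I 2 γ J)
    (h : ∀ s ∈ J, velocity I γ s = 0) (hs₀ : s₀ ∈ J) : EqOn (fun _ => γ s₀) γ J := by
  intro s hs
  refine hJc.isPreconnected.induction₂ (fun s u => γ s = γ u) (fun s hs => ?_)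
    (fun _ _ _ _ _ _ => Eq.trans) (fun _ _ _ _ => Eq.symm) hs₀ hs
  refine nhdsWithin_le_nhds ?_
  have hγs := hγ.contMDiffAt (hJ.mem_nhds hs)
  have hd : ∀ᶠ u in 𝓝 s, HasDerivAt (coordCurve I γ s) 0 u := by
    filter_upwards [eventually_hasDerivAt_coordCurve hγs, hJ.mem_nhds hs,
      hγs.continuousAt.preimage_mem_nhds
        ((chartAt H (γ s)).open_source.mem_nhds (mem_chart_source H (γ s)))] with u hu huJ hmem
    have hv := velocity_comp (mdifferentiableAt_extChartAt (I := I) hmem)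
      ((hγ.contMDiffAt (hJ.mem_nhds huJ)).mdifferentiableAt two_ne_zero)
    rw [h u huJ, map_zero] at hv
    exact ((velocity_eq_deriv (coordCurve I γ s) u).symm.trans hv) ▸ hu
  obtain ⟨ε, hε, hball⟩ := Metric.eventually_nhds_iff_ball.1
    (hd.and (eventually_symm_coordCurve (I := I) hγs.continuousAt))
  filter_upwards [Metric.ball_mem_nhds s hε] with u hu
  have hc : coordCurve I γ s s = coordCurve I γ s u :=
    Metric.isOpen_ball.is_const_of_deriv_eq_zero (convex_ball s ε).isPreconnected
      (fun u hu => (hball u hu).1.differentiableAt.differentiableWithinAt)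
      (fun u hu => (hball u hu).1.deriv) (Metric.mem_ball_self hε) hu
  exact (hball s (Metric.mem_ball_self hε)).2.symm.trans
    ((congrArg (extChartAt I (γ s)).symm hc).trans (hball u hu).2)

end Curves

section Geodesics

variable {E : Type*} [NormedAddCommGroup E] [NormedSpace ℝ E] {H : Type*} [TopologicalSpace H]
  {I : ModelWithCorners ℝ E H} {M : Type*} [TopologicalSpace M] [ChartedSpace H M]
  {g : BilinField I (M := M)} {γ : ℝ → M} {J : Set ℝ} {s s₀ : ℝ}

/-- The covariant acceleration `∇_{γ'} γ'` of `γ` at the parameter `s`, in the chart around `γ s`,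
lowered by `g` and paired with the vector `w`. -/
def loweredAcceleration (g : BilinField I (M := M)) (γ : ℝ → M) (s : ℝ) (w : E) : ℝ :=
  chartComp g (γ s) (coordCurve I γ s s) (deriv (deriv (coordCurve I γ s)) s) w
    + christoffelFirst g (γ s) (coordCurve I γ s s) (deriv (coordCurve I γ s) s)
      (deriv (coordCurve I γ s) s) w

theorem isGeodesicOn_iff : IsGeodesicOn g γ J ↔
    ContMDiffOn 𝓘(ℝ, ℝ) I 2 γ J ∧ ∀ s ∈ J, ∀ w, loweredAcceleration g γ s w = 0 :=
  Iff.rfl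

theorem IsGeodesicOn.contMDiffAt (h : IsGeodesicOn g γ J) (hJ : IsOpen J) (hs : s ∈ J) :
    ContMDiffAt 𝓘(ℝ, ℝ) I 2 γ s :=
  h.1.contMDiffAt (hJ.mem_nhds hs)

theorem CausallyGeodesicallyComplete.nullGeodesicallyComplete
    (h : CausallyGeodesicallyComplete g) : NullGeodesicallyComplete g :=
  fun J γ hJ hJc hne hγ hnull =>
    h J γ hJ hJc hne hγ fun s hs => ⟨(hnull s hs).1, (hnull s hs).2.le⟩

theorem GeodesicallyComplete.nullGeodesicallyComplete (h : GeodesicallyComplete g) :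
    NullGeodesicallyComplete g :=
  fun J γ hJ hJc hne hγ _ => h J γ hJ hJc hne hγ

section FiniteDimensional

variable [FiniteDimensional ℝ E]

/-- The components of `g` in the chart around `x₀`, as a field of continuous bilinear forms on the
model space. -/
def chartBilin (g : BilinField I (M := M)) (x₀ : M) (z : E) : E →L[ℝ] E →L[ℝ] ℝ :=
  LinearMap.toContinuousBilinearMap ((g ((extChartAt I x₀).symm z)).compl₁₂
    (mfderiv 𝓘(ℝ, E) I (extChartAt I x₀).symm z).toLinearMap
    (mfderiv 𝓘(ℝ, E) I (extChartAt I x₀).symm z).toLinearMap)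

theorem chartBilin_apply (g : BilinField I (M := M)) (x₀ : M) (z u v : E) :
    chartBilin g x₀ z u v = chartComp g x₀ z u v :=
  rfl

theorem differentiableAt_chartBilin [I.Boundaryless] {x₀ : M} {z : E}
    (hg : ∀ u v, ContDiffOn ℝ 1 (fun z => chartComp g x₀ z u v) (extChartAt I x₀).target)
    (hz : z ∈ (extChartAt I x₀).target) : DifferentiableAt ℝ (chartBilin g x₀) z :=
  ((contDiffOn_clm_apply.2 fun u => contDiffOn_clm_apply.2 (hg u)).contDiffAt
    ((isOpen_extChartAt_target x₀).mem_nhds hz)).differentiableAt one_ne_zero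

theorem christoffelFirst_self (x₀ : M) {z : E} (hg : DifferentiableAt ℝ (chartBilin g x₀) z)
    (v : E) : christoffelFirst g x₀ z v v v = fderiv ℝ (chartBilin g x₀) z v v v / 2 := by
  have h : fderiv ℝ (fun x => chartComp g x₀ x v v) z v = fderiv ℝ (chartBilin g x₀) z v v v :=
    DFunLike.congr_fun (hasFDerivAt_clm_apply₂_const hg v v).fderiv v
  rw [christoffelFirst, h, add_sub_cancel_right]

theorem hasDerivAt_apply_velocity [I.Boundaryless] [IsManifold I 1 M]
    (hsymm : ∀ x u v, g x u v = g x v u)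
    (hg : ∀ u v, ContDiffOn ℝ 1 (fun z => chartComp g (γ s) z u v) (extChartAt I (γ s)).target)
    (hγ : ContMDiffAt 𝓘(ℝ, ℝ) I 2 γ s) :
    HasDerivAt (fun s => g (γ s) (velocity I γ s) (velocity I γ s))
      (2 * loweredAcceleration g γ s (deriv (coordCurve I γ s) s)) s := by
  have hA := differentiableAt_chartBilin hg (coordCurve_self_mem_target γ s)
  have hc' := hasDerivAt_deriv_coordCurve hγ
  have heq : (fun u => g (γ u) (velocity I γ u) (velocity I γ u)) =ᶠ[𝓝 s] fun u =>
      chartBilin g (γ s) (coordCurve I γ s u) (deriv (coordCurve I γ s) u)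
        (deriv (coordCurve I γ s) u) :=
    (eventually_mk_velocity_eq hγ).mono fun u hu =>
      congrArg (fun v : TangentBundle I M => g v.1 v.2 v.2) hu
  refine ((hasDerivAt_clm_apply₂_comp hA (eventually_hasDerivAt_coordCurve hγ).self_of_nhds
    hc' hc').congr_of_eventuallyEq heq).congr_deriv ?_
  have hflip : ∀ u v, chartComp g (γ s) (coordCurve I γ s s) u v =
    chartComp g (γ s) (coordCurve I γ s s) v u := fun u v => hsymm _ _ _
  rw [loweredAcceleration, christoffelFirst_self _ hA, chartBilin_apply, chartBilin_apply,
    hflip (deriv (coordCurve I γ s) s)]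
  ring

theorem IsGeodesicOn.apply_velocity_eq [I.Boundaryless] [IsManifold I 1 M]
    (h : IsGeodesicOn g γ J) (hsymm : ∀ x u v, g x u v = g x v u)
    (hg : ∀ x u v, ContDiffOn ℝ 1 (fun z => chartComp g x z u v) (extChartAt I x).target)
    (hJ : IsOpen J) (hJc : J.OrdConnected) (hs₀ : s₀ ∈ J) (hs : s ∈ J) :
    g (γ s) (velocity I γ s) (velocity I γ s) = g (γ s₀) (velocity I γ s₀) (velocity I γ s₀) := by
  have hderiv : ∀ s ∈ J, HasDerivAt (fun s => g (γ s) (velocity I γ s) (velocity I γ s)) 0 s :=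
    fun s hs => by
      simpa only [(isGeodesicOn_iff.1 h).2 s hs, mul_zero] using
        hasDerivAt_apply_velocity hsymm (hg (γ s)) (h.contMDiffAt hJ hs)
  exact hJ.is_const_of_deriv_eq_zero hJc.isPreconnected
    (fun s hs => (hderiv s hs).differentiableAt.differentiableWithinAt)
    (fun s hs => (hderiv s hs).deriv) hs hs₀

end FiniteDimensional

end Geodesics

section PartialDerivatives

variable {E G : Type*} [NormedAddCommGroup E] [NormedSpace ℝ E] [NormedAddCommGroup G]
  [NormedSpace ℝ G] {f : ℝ × E → G} {t : ℝ} {x : E}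

theorem deriv_comp_prodMk_left (hf : DifferentiableAt ℝ f (t, x)) :
    deriv (fun t => f (t, x)) t = fderiv ℝ f (t, x) (1, 0) :=
  (hf.hasFDerivAt.comp_hasDerivAt (f := fun t => (t, x)) t
    ((hasDerivAt_id t).prodMk (hasDerivAt_const t x))).deriv

theorem fderiv_comp_prodMk_right (hf : DifferentiableAt ℝ f (t, x)) (w : E) :
    fderiv ℝ (fun x => f (t, x)) x w = fderiv ℝ f (t, x) (0, w) :=
  DFunLike.congr_fun
    (hf.hasFDerivAt.comp (f := fun x => (t, x)) x (hasFDerivAt_prodMk_right t x)).fderiv w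

end PartialDerivatives

/-- A metric, a one-form and a function on the vector space `E`, depending on time: the data of a
Lagrangian in coordinates. The first component of a point of `ℝ × E` is the time. -/
structure LagrangianFields (E : Type*) [NormedAddCommGroup E] [NormedSpace ℝ E] where
  metric : ℝ × E → E →L[ℝ] E →L[ℝ] ℝ
  form : ℝ × E → E →L[ℝ] ℝ
  potential : ℝ × E → ℝ

namespace LagrangianFields

variable {E : Type*} [NormedAddCommGroup E] [NormedSpace ℝ E] (F : LagrangianFields E)

/-- The metric, the one-form and the function are of class `C^1` around `p`. -/
structure IsC1At (p : ℝ × E) : Prop where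
  metric : ContDiffAt ℝ 1 F.metric p
  form : ContDiffAt ℝ 1 F.form p
  potential : ContDiffAt ℝ 1 F.potential p

/-- The Lagrangian `L_k(t, x, v) = a(v, v) / 2 + k b(v) - k² V` of the curves `x(s)` along which
time runs at the constant rate `t' = k`: it is `k² L(t, x, v / k)` if `k ≠ 0`, and the kinetic
energy if `k = 0`. -/
def lagrangian (k : ℝ) (p : ℝ × E) (v : E) : ℝ :=
  F.metric p v v / 2 + k * F.form p v - k ^ 2 * F.potential p

/-- The left-hand side, paired with `w`, of the Euler-Lagrange equation
`d/ds (∂L_k/∂v) - ∂L_k/∂x = 0` along a curve in `ℝ × E` with `t' = k` that passes through `p` with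
velocity `v` and acceleration `z` in `E`. -/
def eulerLagrange (k : ℝ) (p : ℝ × E) (v z w : E) : ℝ :=
  F.metric p z w + fderiv ℝ F.metric p (k, v) v w + k * fderiv ℝ F.form p (k, v) w
    - fderiv ℝ (fun p => F.lagrangian k p v) p (0, w)

/-- The momentum `∂L_k/∂k` conjugate to time. -/
def momentum (k : ℝ) (p : ℝ × E) (v : E) : ℝ :=
  F.form p v - 2 * k * F.potential p

/-- The derivative of the momentum along a curve in `ℝ × E` with `t' = k` that passes through `p`
with velocity `v` and acceleration `z` in `E`. -/
def momentumRate (k : ℝ) (p : ℝ × E) (v z : E) : ℝ :=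
  fderiv ℝ F.form p (k, v) v + F.form p z - 2 * k * fderiv ℝ F.potential p (k, v)

/-- The partial derivative `∂L_k/∂t`. -/
def timeForce (k : ℝ) (p : ℝ × E) (v : E) : ℝ :=
  fderiv ℝ (fun p => F.lagrangian k p v) p (1, 0)

/-- The metric `a - dt ⊗ (dy - b) - (dy - b) ⊗ dt - 2 V dt ⊗ dt` on `ℝ × E × ℝ`, at the point
`z` and on the vectors `u v`. -/
def brinkmann (z u v : ℝ × E × ℝ) : ℝ :=
  F.metric (z.1, z.2.1) u.2.1 v.2.1 - u.1 * (v.2.2 - F.form (z.1, z.2.1) v.2.1)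
    - (u.2.2 - F.form (z.1, z.2.1) u.2.1) * v.1 - 2 * F.potential (z.1, z.2.1) * (u.1 * v.1)

theorem lagrangian_smul (k m : ℝ) (p : ℝ × E) (v : E) :
    F.lagrangian (k * m) p (m • v) = m ^ 2 * F.lagrangian k p v := by
  simp only [lagrangian, map_smul, smul_apply, smul_eq_mul]
  ring

theorem eulerLagrange_smul (k m : ℝ) (p : ℝ × E) (v z w : E) :
    F.eulerLagrange (k * m) p (m • v) (m • m • z) w = m ^ 2 * F.eulerLagrange k p v z w := by
  have hv : (k * m, m • v) = m • (k, v) := by simp [mul_comm]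
  have hL : fderiv ℝ (fun p => F.lagrangian (k * m) p (m • v)) p (0, w)
      = m ^ 2 * fderiv ℝ (fun p => F.lagrangian k p v) p (0, w) := by
    simp only [lagrangian_smul]
    exact DFunLike.congr_fun (congrFun (fderiv_const_smul_field (m ^ 2)) p) (0, w)
  simp only [eulerLagrange, hv, hL, map_smul, smul_apply, smul_eq_mul]
  ring

theorem eulerLagrange_zero (p : ℝ × E) (w : E) : F.eulerLagrange 0 p 0 0 w = 0 := by
  simp [eulerLagrange, lagrangian]

variable {F} {p : ℝ × E}

namespace IsC1At

theorem differentiableAt_metric (h : F.IsC1At p) : DifferentiableAt ℝ F.metric p :=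
  h.metric.differentiableAt one_ne_zero

theorem differentiableAt_form (h : F.IsC1At p) : DifferentiableAt ℝ F.form p :=
  h.form.differentiableAt one_ne_zero

theorem differentiableAt_potential (h : F.IsC1At p) : DifferentiableAt ℝ F.potential p :=
  h.potential.differentiableAt one_ne_zero

theorem differentiableAt_lagrangian (h : F.IsC1At p) (k : ℝ) (v : E) :
    DifferentiableAt ℝ (fun p => F.lagrangian k p v) p := by
  have hA := h.differentiableAt_metric
  have hB := h.differentiableAt_form
  have hV := h.differentiableAt_potential
  unfold lagrangian
  fun_prop

protected theorem eventually (h : F.IsC1At p) : ∀ᶠ p in 𝓝 p, F.IsC1At p := by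
  filter_upwards [h.metric.eventually (by simp), h.form.eventually (by simp),
    h.potential.eventually (by simp)] with p hA hB hV using ⟨hA, hB, hV⟩

set_option maxSynthPendingDepth 3 in
theorem fderiv_lagrangian (h : F.IsC1At p) (k : ℝ) (v : E) (u : ℝ × E) :
    fderiv ℝ (fun p => F.lagrangian k p v) p u = fderiv ℝ F.metric p u v v / 2
      + k * fderiv ℝ F.form p u v - k ^ 2 * fderiv ℝ F.potential p u := by
  have hL := (((hasFDerivAt_clm_apply₂_const h.differentiableAt_metric v v).mul_const 2⁻¹).fun_add
    ((hasFDerivAt_clm_apply_const h.differentiableAt_form v).const_mul k)).fun_sub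
    (h.differentiableAt_potential.hasFDerivAt.const_mul (k ^ 2))
  refine (DFunLike.congr_fun hL.fderiv u).trans ?_
  simp only [sub_apply, add_apply, smul_apply, ContinuousLinearMap.flip_apply, smul_eq_mul]
  ring

theorem hasDerivAt_momentum (h : F.IsC1At p) {c : ℝ → ℝ × E} {v : ℝ → E} {s k : ℝ} {z : E}
    (hp : c s = p) (hc : HasDerivAt c (k, v s) s) (hv : HasDerivAt v z s) :
    HasDerivAt (fun s => F.momentum k (c s) (v s)) (F.momentumRate k p (v s) z) s := by
  subst hp
  exact (hasDerivAt_clm_apply_comp h.differentiableAt_form hc hv).sub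
    ((h.differentiableAt_potential.hasFDerivAt.comp_hasDerivAt s hc).const_mul (2 * k))

theorem contDiffAt_momentum {c : ℝ → ℝ × E} {v : ℝ → E} {s : ℝ} (h : F.IsC1At (c s))
    (hc : ContDiffAt ℝ 1 c s) (hv : ContDiffAt ℝ 1 v s) (k : ℝ) :
    ContDiffAt ℝ 1 (fun s => F.momentum k (c s) (v s)) s :=
  ((h.form.comp s hc).clm_apply hv).sub (contDiffAt_const.mul (h.potential.comp s hc))

set_option maxSynthPendingDepth 3 in
theorem continuousAt_timeForce {c : ℝ → ℝ × E} {v : ℝ → E} {s : ℝ} (h : F.IsC1At (c s))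
    (hc : ContinuousAt c s) (hv : ContinuousAt v s) (k : ℝ) :
    ContinuousAt (fun s => F.timeForce k (c s) (v s)) s := by
  have hA : ContinuousAt (fun s => fderiv ℝ F.metric (c s)) s :=
    (h.metric.continuousAt_fderiv one_ne_zero).comp hc
  have hB : ContinuousAt (fun s => fderiv ℝ F.form (c s)) s :=
    (h.form.continuousAt_fderiv one_ne_zero).comp hc
  have hV : ContinuousAt (fun s => fderiv ℝ F.potential (c s)) s :=
    (h.potential.continuousAt_fderiv one_ne_zero).comp hc
  have heq : (fun s => F.timeForce k (c s) (v s)) =ᶠ[𝓝 s] fun s =>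
      fderiv ℝ F.metric (c s) (1, 0) (v s) (v s) / 2 + k * fderiv ℝ F.form (c s) (1, 0) (v s)
        - k ^ 2 * fderiv ℝ F.potential (c s) (1, 0) :=
    (hc.eventually h.eventually).mono fun s hs => hs.fderiv_lagrangian k (v s) (1, 0)
  exact ((((((hA.clm_apply continuousAt_const).clm_apply hv).clm_apply hv).div_const 2).add
    (continuousAt_const.mul ((hB.clm_apply continuousAt_const).clm_apply hv))).sub
    (continuousAt_const.mul (hV.clm_apply continuousAt_const))).congr heq.symm

theorem contDiffAt_brinkmann {z : ℝ × E × ℝ} (h : F.IsC1At (z.1, z.2.1)) (u v : ℝ × E × ℝ) :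
    ContDiffAt ℝ 1 (fun z => F.brinkmann z u v) z := by
  have hp : ContDiffAt ℝ 1 (fun z : ℝ × E × ℝ => (z.1, z.2.1)) z := by fun_prop
  have hA : ContDiffAt ℝ 1 (fun z : ℝ × E × ℝ => F.metric (z.1, z.2.1)) z := h.metric.comp z hp
  have hB : ContDiffAt ℝ 1 (fun z : ℝ × E × ℝ => F.form (z.1, z.2.1)) z := h.form.comp z hp
  have hV : ContDiffAt ℝ 1 (fun z : ℝ × E × ℝ => F.potential (z.1, z.2.1)) z :=
    h.potential.comp z hp
  unfold brinkmann
  fun_prop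

theorem fderiv_brinkmann {z : ℝ × E × ℝ} (h : F.IsC1At (z.1, z.2.1)) (u v w : ℝ × E × ℝ) :
    fderiv ℝ (fun z => F.brinkmann z v w) z u
      = fderiv ℝ F.metric (z.1, z.2.1) (u.1, u.2.1) v.2.1 w.2.1
        + v.1 * fderiv ℝ F.form (z.1, z.2.1) (u.1, u.2.1) w.2.1
        + w.1 * fderiv ℝ F.form (z.1, z.2.1) (u.1, u.2.1) v.2.1
        - 2 * fderiv ℝ F.potential (z.1, z.2.1) (u.1, u.2.1) * (v.1 * w.1) := by
  let π : ℝ × E × ℝ →L[ℝ] ℝ × E := (ContinuousLinearMap.fst ℝ ℝ (E × ℝ)).prod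
    ((ContinuousLinearMap.fst ℝ E ℝ).comp (ContinuousLinearMap.snd ℝ ℝ (E × ℝ)))
  have hA := (hasFDerivAt_clm_apply₂_const h.differentiableAt_metric v.2.1 w.2.1).comp z
    π.hasFDerivAt
  have hB := fun x : E => (hasFDerivAt_clm_apply_const h.differentiableAt_form x).comp z
    π.hasFDerivAt
  have hV := h.differentiableAt_potential.hasFDerivAt.comp z π.hasFDerivAt
  have hF := ((hA.fun_sub (((hB w.2.1).const_sub w.2.2).const_mul v.1)).fun_sub
    (((hB v.2.1).const_sub v.2.2).mul_const w.1)).fun_sub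
    ((hV.const_mul 2).mul_const (v.1 * w.1))
  refine (DFunLike.congr_fun hF.fderiv u).trans ?_
  simp only [π, smul_neg, sub_neg_eq_add, sub_apply, add_apply, smul_apply, smul_eq_mul,
    ContinuousLinearMap.comp_apply, ContinuousLinearMap.prod_apply, ContinuousLinearMap.coe_fst',
    ContinuousLinearMap.coe_snd', ContinuousLinearMap.flip_apply]
  ring

/-- The `x`-, `y`- and `t`-components of the geodesic equation of the Brinkmann metric are the
Euler-Lagrange equations of its energy `L_{t'} - t' y'`. -/
theorem brinkmann_add_christoffel {z : ℝ × E × ℝ} (h : F.IsC1At (z.1, z.2.1))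
    (v a w : ℝ × E × ℝ) :
    F.brinkmann z a w + (fderiv ℝ (fun z => F.brinkmann z v w) z v
        + fderiv ℝ (fun z => F.brinkmann z v w) z v
        - fderiv ℝ (fun z => F.brinkmann z v v) z w) / 2
      = F.eulerLagrange v.1 (z.1, z.2.1) v.2.1 a.2.1 w.2.1
        + a.1 * (F.momentum w.1 (z.1, z.2.1) w.2.1 - w.2.2)
        + w.1 * (F.momentumRate v.1 (z.1, z.2.1) v.2.1 a.2.1
          - F.timeForce v.1 (z.1, z.2.1) v.2.1 - a.2.2) := by
  have hw : (w.1, w.2.1) = w.1 • ((1 : ℝ), (0 : E)) + (0, w.2.1) := by simp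
  simp only [h.fderiv_brinkmann]
  simp only [brinkmann, eulerLagrange, momentum, momentumRate, timeForce, h.fderiv_lagrangian]
  rw [hw]
  simp only [map_add, map_smul, add_apply, smul_apply, smul_eq_mul]
  ring

end IsC1At

theorem fderiv_lagrangian_velocity (hsymm : ∀ u v, F.metric p u v = F.metric p v u) (k : ℝ)
    (v w : E) :
    fderiv ℝ (F.lagrangian k p) v w = F.metric p v w + k * F.form p w := by
  have hA : HasFDerivAt (fun v => F.metric p v v) (F.metric p v + (F.metric p).flip v) v := by
    simpa using (F.metric p).hasFDerivAt.clm_apply (hasFDerivAt_id v)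
  have h := ((hA.const_mul 2⁻¹).fun_add ((F.form p).hasFDerivAt.const_mul k)).sub_const
    (k ^ 2 * F.potential p)
  simp only [← div_eq_inv_mul] at h
  refine (DFunLike.congr_fun h.fderiv w).trans ?_
  simp only [smul_add, add_apply, smul_apply, smul_eq_mul, ContinuousLinearMap.flip_apply,
    hsymm w v]
  ring

theorem IsC1At.hasDerivAt_fderiv_lagrangian_velocity (h : F.IsC1At p) {c : ℝ → ℝ × E} {v : ℝ → E}
    {s k : ℝ} {z : E} (hp : c s = p) (hc : HasDerivAt c (k, v s) s) (hv : HasDerivAt v z s)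
    (hsymm : ∀ᶠ s in 𝓝 s, ∀ u v, F.metric (c s) u v = F.metric (c s) v u) (w : E) :
    HasDerivAt (fun s => fderiv ℝ (F.lagrangian k (c s)) (v s) w)
      (F.eulerLagrange k p (v s) z w + fderiv ℝ (fun p => F.lagrangian k p (v s)) p (0, w)) s := by
  subst hp
  have heq : (fun s => fderiv ℝ (F.lagrangian k (c s)) (v s) w) =ᶠ[𝓝 s]
      fun s => F.metric (c s) (v s) w + k * F.form (c s) w :=
    hsymm.mono fun s hs => fderiv_lagrangian_velocity hs k (v s) w
  have hw := hasDerivAt_const s w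
  refine (((hasDerivAt_clm_apply₂_comp h.differentiableAt_metric hc hv hw).add
    ((hasDerivAt_clm_apply_comp h.differentiableAt_form hc hw).const_mul k)).congr_of_eventuallyEq
    heq).congr_deriv ?_
  simp only [eulerLagrange, map_zero]
  ring

end LagrangianFields

namespace MechanicalSystem

variable {d : ℕ} {Q : Type*} [TopologicalSpace Q] [ChartedSpace (EuclideanSpace ℝ (Fin d)) Q]
  {r : WithTop ℕ∞} (S : MechanicalSystem d Q r)

local notation "𝔼" => EuclideanSpace ℝ (Fin d)

section Charts

/-- The metric, the one-form and the potential of `S` in the chart of `Q` around `q₀`. -/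
def fieldsInChart (q₀ : Q) : LagrangianFields 𝔼 where
  metric p := chartBilin (S.a p.1) q₀ p.2
  form p := (S.b p.1 ((extChartAt (𝓡 d) q₀).symm p.2)).comp
    (mfderiv 𝓘(ℝ, 𝔼) (𝓡 d) (extChartAt (𝓡 d) q₀).symm p.2)
  potential p := S.V p.1 ((extChartAt (𝓡 d) q₀).symm p.2)

theorem isC1At_fieldsInChart (hr : 1 ≤ r) {q₀ : Q} {t : ℝ} {x : 𝔼} (ht : t ∈ S.T)
    (hx : x ∈ (extChartAt (𝓡 d) q₀).target) : (S.fieldsInChart q₀).IsC1At (t, x) := by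
  have hmem : (S.T : Set ℝ) ×ˢ (extChartAt (𝓡 d) q₀).target ∈ 𝓝 (t, x) :=
    (S.T.isOpen.prod (isOpen_extChartAt_target q₀)).mem_nhds ⟨ht, hx⟩
  have hA : ContDiffOn ℝ 1 (S.fieldsInChart q₀).metric
      ((S.T : Set ℝ) ×ˢ (extChartAt (𝓡 d) q₀).target) :=
    contDiffOn_clm_apply.2 fun u => contDiffOn_clm_apply.2 fun v => (S.a_smooth q₀ u v).of_le hr
  have hB : ContDiffOn ℝ 1 (S.fieldsInChart q₀).form
      ((S.T : Set ℝ) ×ˢ (extChartAt (𝓡 d) q₀).target) :=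
    contDiffOn_clm_apply.2 fun v => (S.b_smooth q₀ v).of_le hr
  exact ⟨hA.contDiffAt hmem, hB.contDiffAt hmem, ((S.V_smooth q₀).of_le hr).contDiffAt hmem⟩

theorem isC1At_fieldsInChart_self (hr : 1 ≤ r) (q : ℝ → Q) {t : ℝ} (ht : t ∈ S.T) (s : ℝ) :
    (S.fieldsInChart (q s)).IsC1At (t, coordCurve (𝓡 d) q s s) :=
  S.isC1At_fieldsInChart hr ht (coordCurve_self_mem_target q s)

theorem lagrangian_one_fieldsInChart (q₀ : Q) (t : ℝ) (x v : 𝔼) :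
    (S.fieldsInChart q₀).lagrangian 1 (t, x) v = S.chartLagrangian q₀ t x v := by
  simp only [LagrangianFields.lagrangian, one_mul, one_pow]
  rfl

end Charts

section Eisenhart

theorem mem_target_extChartAt_spacetime {x₀ : S.Spacetime} {z : ℝ × 𝔼 × ℝ} :
    z ∈ (extChartAt (spacetimeModel d) x₀).target ↔
      z.1 ∈ S.T ∧ z.2.1 ∈ (extChartAt (𝓡 d) x₀.2.1).target := by
  have hT : (extChartAt 𝓘(ℝ, ℝ) x₀.1).target = S.T := by
    simp [TopologicalSpace.Opens.chartAt_eq, chartAt_self_eq, extChartAt,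
      OpenPartialHomeomorph.subtypeRestr_def]
  have hR : (extChartAt 𝓘(ℝ, ℝ) x₀.2.2).target = univ := by simp [chartAt_self_eq]
  simp only [extChartAt_prod, PartialEquiv.prod_target, hT, hR, mem_prod, mem_univ, and_true]
  rfl

theorem extChartAt_symm_spacetime_fst {x₀ : S.Spacetime} {z : ℝ × 𝔼 × ℝ}
    (hz : z ∈ (extChartAt (spacetimeModel d) x₀).target) :
    (((extChartAt (spacetimeModel d) x₀).symm z).1 : ℝ) = z.1 :=
  congrArg Prod.fst ((extChartAt (spacetimeModel d) x₀).right_inv hz)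

theorem mdifferentiableAt_time (x : S.Spacetime) :
    MDifferentiableAt (spacetimeModel d) 𝓘(ℝ, ℝ) (fun p : S.Spacetime => (p.1 : ℝ)) x :=
  (contMDiff_subtype_val (n := 1) |>.comp contMDiff_fst).contMDiffAt.mdifferentiableAt one_ne_zero

theorem mdifferentiableAt_position (x : S.Spacetime) :
    MDifferentiableAt (spacetimeModel d) (𝓡 d) (fun p : S.Spacetime => p.2.1) x :=
  (contMDiff_fst (n := 1) |>.comp contMDiff_snd).contMDiffAt.mdifferentiableAt one_ne_zero

theorem mdifferentiableAt_height (x : S.Spacetime) :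
    MDifferentiableAt (spacetimeModel d) 𝓘(ℝ, ℝ) (fun p : S.Spacetime => p.2.2) x :=
  (contMDiff_snd (n := 1) |>.comp contMDiff_snd).contMDiffAt.mdifferentiableAt one_ne_zero

section Velocity

variable {γ : ℝ → S.Spacetime} {s : ℝ}
  (hγ : MDifferentiableAt 𝓘(ℝ, ℝ) (spacetimeModel d) γ s)
include hγ

theorem dt_velocity :
    S.dt (γ s) (velocity (spacetimeModel d) γ s) = deriv (fun s => ((γ s).1 : ℝ)) s :=
  (velocity_comp (S.mdifferentiableAt_time (γ s)) hγ).symm.trans (velocity_eq_deriv _ s)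

theorem dy_velocity :
    S.dy (γ s) (velocity (spacetimeModel d) γ s) = deriv (fun s => (γ s).2.2) s :=
  (velocity_comp (S.mdifferentiableAt_height (γ s)) hγ).symm.trans (velocity_eq_deriv _ s)

theorem dq_velocity :
    S.dq (γ s) (velocity (spacetimeModel d) γ s) = velocity (𝓡 d) (fun s => (γ s).2.1) s :=
  (velocity_comp (S.mdifferentiableAt_position (γ s)) hγ).symm

end Velocity

theorem eisenhartMetric_symm (x : S.Spacetime) (u v : TangentSpace (spacetimeModel d) x) :
    S.eisenhartMetric x u v = S.eisenhartMetric x v u := by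
  simp only [eisenhartMetric, LinearMap.mk₂_apply, S.a_symm x.1 x.1.2 x.2.1 (S.dq x u)]
  ring

section MfderivChart

variable [IsManifold (𝓡 d) 1 Q]

theorem dt_mfderiv_extChartAt_symm {x₀ : S.Spacetime} {z : ℝ × 𝔼 × ℝ}
    (hz : z ∈ (extChartAt (spacetimeModel d) x₀).target) (u : ℝ × 𝔼 × ℝ) :
    S.dt ((extChartAt (spacetimeModel d) x₀).symm z)
      (mfderiv 𝓘(ℝ, ℝ × 𝔼 × ℝ) (spacetimeModel d) (extChartAt (spacetimeModel d) x₀).symm z u)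
      = u.1 := by
  have heq : (fun p : S.Spacetime => (p.1 : ℝ)) ∘ (extChartAt (spacetimeModel d) x₀).symm
      =ᶠ[𝓝 z] Prod.fst :=
    Filter.eventuallyEq_of_mem ((isOpen_extChartAt_target x₀).mem_nhds hz)
      fun _ => S.extChartAt_symm_spacetime_fst
  refine (mfderiv_comp_apply z (S.mdifferentiableAt_time _)
    (mdifferentiableAt_extChartAt_symm hz) u).symm.trans ?_
  rw [heq.mfderiv_eq, mfderiv_eq_fderiv, fderiv_fst]
  rfl

theorem dy_mfderiv_extChartAt_symm {x₀ : S.Spacetime} {z : ℝ × 𝔼 × ℝ}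
    (hz : z ∈ (extChartAt (spacetimeModel d) x₀).target) (u : ℝ × 𝔼 × ℝ) :
    S.dy ((extChartAt (spacetimeModel d) x₀).symm z)
      (mfderiv 𝓘(ℝ, ℝ × 𝔼 × ℝ) (spacetimeModel d) (extChartAt (spacetimeModel d) x₀).symm z u)
      = u.2.2 := by
  have h := (hasFDerivAt_snd (𝕜 := ℝ) (p := z)).snd
  refine (mfderiv_comp_apply z (S.mdifferentiableAt_height _)
    (mdifferentiableAt_extChartAt_symm hz) u).symm.trans ?_
  exact (congrArg (fun L : ℝ × 𝔼 × ℝ →L[ℝ] ℝ => L u) (mfderiv_eq_fderiv.trans h.fderiv))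

theorem dq_mfderiv_extChartAt_symm {x₀ : S.Spacetime} {z : ℝ × 𝔼 × ℝ}
    (hz : z ∈ (extChartAt (spacetimeModel d) x₀).target) (u : ℝ × 𝔼 × ℝ) :
    S.dq ((extChartAt (spacetimeModel d) x₀).symm z)
      (mfderiv 𝓘(ℝ, ℝ × 𝔼 × ℝ) (spacetimeModel d) (extChartAt (spacetimeModel d) x₀).symm z u)
      = mfderiv 𝓘(ℝ, 𝔼) (𝓡 d) (extChartAt (𝓡 d) x₀.2.1).symm z.2.1 u.2.1 := by
  have h := (hasFDerivAt_snd (𝕜 := ℝ) (p := z)).fst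
  refine (mfderiv_comp_apply z (S.mdifferentiableAt_position _)
    (mdifferentiableAt_extChartAt_symm hz) u).symm.trans ?_
  refine (mfderiv_comp_apply z
    (mdifferentiableAt_extChartAt_symm (S.mem_target_extChartAt_spacetime.1 hz).2)
    h.hasMFDerivAt.mdifferentiableAt u).trans ?_
  rw [mfderiv_eq_fderiv, h.fderiv]
  rfl

theorem chartComp_eisenhartMetric {x₀ : S.Spacetime} {z : ℝ × 𝔼 × ℝ}
    (hz : z ∈ (extChartAt (spacetimeModel d) x₀).target) (u v : ℝ × 𝔼 × ℝ) :
    chartComp S.eisenhartMetric x₀ z u v = (S.fieldsInChart x₀.2.1).brinkmann z u v := by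
  simp only [chartComp, eisenhartMetric, LinearMap.mk₂_apply, dyb, sub_apply,
    ContinuousLinearMap.comp_apply, S.dt_mfderiv_extChartAt_symm hz,
    S.dy_mfderiv_extChartAt_symm hz, S.dq_mfderiv_extChartAt_symm hz,
    S.extChartAt_symm_spacetime_fst hz]
  rfl

end MfderivChart

theorem contDiffOn_chartComp_eisenhartMetric [IsManifold (𝓡 d) 1 Q] (hr : 1 ≤ r)
    (x₀ : S.Spacetime) (u v : ℝ × 𝔼 × ℝ) :
    ContDiffOn ℝ 1 (fun z => chartComp S.eisenhartMetric x₀ z u v)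
      (extChartAt (spacetimeModel d) x₀).target :=
  ContDiffOn.congr (fun _ hz =>
    have h := S.mem_target_extChartAt_spacetime.1 hz
    ((S.isC1At_fieldsInChart hr h.1 h.2).contDiffAt_brinkmann u v).contDiffWithinAt)
    fun _ hz => S.chartComp_eisenhartMetric hz u v

end Eisenhart

section ReducedEquation

/-- The Lagrangian `L_k = a_t(v, v) / 2 + k b_t(v) - k² V` of the curves in `Q` along which time
runs at the constant rate `k`, as in `LagrangianFields.lagrangian`. -/
def scaledLagrangian (k t : ℝ) (q : Q) (v : TangentSpace (𝓡 d) q) : ℝ :=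
  S.a t q v v / 2 + k * S.b t q v - k ^ 2 * S.V t q

/-- The momentum `∂L_k/∂k` conjugate to time, along the curve `q` with time `t = k s + c`. -/
def momentum (k c : ℝ) (q : ℝ → Q) (s : ℝ) : ℝ :=
  S.b (k * s + c) (q s) (velocity (𝓡 d) q s) - 2 * k * S.V (k * s + c) (q s)

/-- The partial derivative `∂L_k/∂t`, along the curve `q` with time `t = k s + c`. -/
def timeForce (k c : ℝ) (q : ℝ → Q) (s : ℝ) : ℝ :=
  deriv (fun t => S.scaledLagrangian k t (q s) (velocity (𝓡 d) q s)) (k * s + c)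

/-- The left-hand side, paired with `w`, of the Euler-Lagrange equation of `L_k` along the curve
`q` with time `t = k s + c`, in the chart around `q s`. -/
def eulerLagrange (k c : ℝ) (q : ℝ → Q) (s : ℝ) (w : 𝔼) : ℝ :=
  (S.fieldsInChart (q s)).eulerLagrange k (k * s + c, coordCurve (𝓡 d) q s s)
    (deriv (coordCurve (𝓡 d) q s) s) (deriv (deriv (coordCurve (𝓡 d) q s)) s) w

/-- `q` solves the Euler-Lagrange equation of `L_k` with time `t = k s + c`, for `s` in the open
set `J`. The Euler-Lagrange equation of `S` is the case `k = 1`, `c = 0`, and the geodesic equation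
of `a_c` is the case `k = 0`. -/
structure IsReducedSolutionOn (k c : ℝ) (q : ℝ → Q) (J : Set ℝ) : Prop where
  time_mem : ∀ s ∈ J, k * s + c ∈ S.T
  contMDiffOn : ContMDiffOn 𝓘(ℝ, ℝ) (𝓡 d) 2 q J
  eulerLagrange_eq_zero : ∀ s ∈ J, ∀ w, S.eulerLagrange k c q s w = 0

theorem hasDerivAt_timeCurve {q : ℝ → Q} {s₀ s : ℝ} (k c : ℝ)
    (h : HasDerivAt (coordCurve (𝓡 d) q s₀) (deriv (coordCurve (𝓡 d) q s₀) s) s) :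
    HasDerivAt (fun s => (k * s + c, coordCurve (𝓡 d) q s₀ s))
      (k, deriv (coordCurve (𝓡 d) q s₀) s) s :=
  (hasDerivAt_mul_add_const k c s).prodMk h

theorem momentum_congr {q q' : ℝ → Q} {s : ℝ} (k c : ℝ) (h : q =ᶠ[𝓝 s] q') :
    S.momentum k c q s = S.momentum k c q' s :=
  congrArg (fun v : TangentBundle (𝓡 d) Q =>
    S.b (k * s + c) v.1 v.2 - 2 * k * S.V (k * s + c) v.1) (mk_velocity_congr h)

theorem timeForce_congr {q q' : ℝ → Q} {s : ℝ} (k c : ℝ) (h : q =ᶠ[𝓝 s] q') :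
    S.timeForce k c q s = S.timeForce k c q' s :=
  congrArg (fun v : TangentBundle (𝓡 d) Q =>
    deriv (fun t => S.scaledLagrangian k t v.1 v.2) (k * s + c)) (mk_velocity_congr h)

section AlongCurve

variable [IsManifold (𝓡 d) 1 Q] {q : ℝ → Q} {s₀ : ℝ}

theorem eventually_momentum_eq (hq : ContMDiffAt 𝓘(ℝ, ℝ) (𝓡 d) 2 q s₀) (k c : ℝ) :
    S.momentum k c q =ᶠ[𝓝 s₀] fun s => (S.fieldsInChart (q s₀)).momentum k
      (k * s + c, coordCurve (𝓡 d) q s₀ s) (deriv (coordCurve (𝓡 d) q s₀) s) :=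
  (eventually_mk_velocity_eq hq).mono fun s hs =>
    congrArg (fun v : TangentBundle (𝓡 d) Q =>
      S.b (k * s + c) v.1 v.2 - 2 * k * S.V (k * s + c) v.1) hs

variable {k c : ℝ}

theorem hasDerivAt_momentum (hr : 1 ≤ r) (hq : ContMDiffAt 𝓘(ℝ, ℝ) (𝓡 d) 2 q s₀)
    (ht : k * s₀ + c ∈ S.T) :
    HasDerivAt (S.momentum k c q)
      ((S.fieldsInChart (q s₀)).momentumRate k (k * s₀ + c, coordCurve (𝓡 d) q s₀ s₀)
        (deriv (coordCurve (𝓡 d) q s₀) s₀) (deriv (deriv (coordCurve (𝓡 d) q s₀)) s₀)) s₀ :=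
  ((S.isC1At_fieldsInChart_self hr q ht s₀).hasDerivAt_momentum rfl
    (hasDerivAt_timeCurve k c (eventually_hasDerivAt_coordCurve hq).self_of_nhds)
    (hasDerivAt_deriv_coordCurve hq)).congr_of_eventuallyEq (S.eventually_momentum_eq hq k c)

theorem contDiffAt_momentum (hr : 1 ≤ r) (hq : ContMDiffAt 𝓘(ℝ, ℝ) (𝓡 d) 2 q s₀)
    (ht : k * s₀ + c ∈ S.T) : ContDiffAt ℝ 1 (S.momentum k c q) s₀ := by
  have hc : ContDiffAt ℝ 1 (fun s => (k * s + c, coordCurve (𝓡 d) q s₀ s)) s₀ :=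
    ContDiffAt.prodMk (by fun_prop) ((contDiffAt_coordCurve hq).of_le one_le_two)
  exact ((S.isC1At_fieldsInChart_self hr q ht s₀).contDiffAt_momentum hc
    (contDiffAt_deriv_coordCurve hq) k).congr_of_eventuallyEq (S.eventually_momentum_eq hq k c)

theorem eventually_timeForce_eq (hr : 1 ≤ r) (hq : ContMDiffAt 𝓘(ℝ, ℝ) (𝓡 d) 2 q s₀)
    (ht : k * s₀ + c ∈ S.T) :
    S.timeForce k c q =ᶠ[𝓝 s₀] fun s => (S.fieldsInChart (q s₀)).timeForce k
      (k * s + c, coordCurve (𝓡 d) q s₀ s) (deriv (coordCurve (𝓡 d) q s₀) s) := by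
  have htime : ∀ᶠ s in 𝓝 s₀, k * s + c ∈ S.T :=
    ContinuousAt.eventually_mem (by fun_prop) (S.T.isOpen.mem_nhds ht)
  filter_upwards [eventually_mk_velocity_eq hq, htime,
    eventually_coordCurve_mem_target (I := 𝓡 d) hq.continuousAt] with s hs hsT hmem
  refine (congrArg (fun v : TangentBundle (𝓡 d) Q =>
    deriv (fun t => S.scaledLagrangian k t v.1 v.2) (k * s + c)) hs).trans ?_
  exact deriv_comp_prodMk_left
    ((S.isC1At_fieldsInChart hr hsT hmem).differentiableAt_lagrangian k _)

theorem continuousAt_timeForce (hr : 1 ≤ r) (hq : ContMDiffAt 𝓘(ℝ, ℝ) (𝓡 d) 2 q s₀)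
    (ht : k * s₀ + c ∈ S.T) : ContinuousAt (S.timeForce k c q) s₀ := by
  have hc : ContinuousAt (fun s => (k * s + c, coordCurve (𝓡 d) q s₀ s)) s₀ :=
    ContinuousAt.prodMk (by fun_prop) (contDiffAt_coordCurve hq).continuousAt
  exact ((S.isC1At_fieldsInChart_self hr q ht s₀).continuousAt_timeForce hc
    (contDiffAt_deriv_coordCurve hq).continuousAt k).congr
    (S.eventually_timeForce_eq hr hq ht).symm

end AlongCurve

theorem deriv_fderiv_chartLagrangian_sub [IsManifold (𝓡 d) 1 Q] (hr : 1 ≤ r) {q : ℝ → Q} {t : ℝ}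
    (ht : t ∈ S.T) (hq : ContMDiffAt 𝓘(ℝ, ℝ) (𝓡 d) 2 q t) (w : 𝔼) :
    deriv (fun u => fderiv ℝ (S.chartLagrangian (q t) u (coordCurve (𝓡 d) q t u))
        (deriv (coordCurve (𝓡 d) q t) u) w) t
      - fderiv ℝ (fun x => S.chartLagrangian (q t) t x (deriv (coordCurve (𝓡 d) q t) t))
        (coordCurve (𝓡 d) q t t) w
      = S.eulerLagrange 1 0 q t w := by
  have hC := S.isC1At_fieldsInChart_self hr q ht t
  have hsymm : ∀ᶠ u in 𝓝 t, ∀ v v', (S.fieldsInChart (q t)).metric (u, coordCurve (𝓡 d) q t u) v v'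
      = (S.fieldsInChart (q t)).metric (u, coordCurve (𝓡 d) q t u) v' v := by
    filter_upwards [S.T.isOpen.mem_nhds ht] with u hu v v' using S.a_symm u hu _ _ _
  have hderiv := hC.hasDerivAt_fderiv_lagrangian_velocity rfl
    ((hasDerivAt_id t).prodMk (eventually_hasDerivAt_coordCurve hq).self_of_nhds)
    (hasDerivAt_deriv_coordCurve hq) hsymm w
  have hL : ∀ u x, (S.fieldsInChart (q t)).lagrangian 1 (u, x) = S.chartLagrangian (q t) u x :=
    fun u x => funext fun v => S.lagrangian_one_fieldsInChart (q t) u x v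
  rw [← fderiv_comp_prodMk_right (hC.differentiableAt_lagrangian 1 _)] at hderiv
  simp only [hL, id] at hderiv
  rw [hderiv.deriv, add_sub_cancel_right, eulerLagrange, one_mul, add_zero]

theorem isELSolutionOn_iff [IsManifold (𝓡 d) 1 Q] (hr : 1 ≤ r) {q : ℝ → Q} {J : Set ℝ}
    (hJ : IsOpen J) : S.IsELSolutionOn q J ↔ S.IsReducedSolutionOn 1 0 q J := by
  have hEL : J ⊆ S.T → ContMDiffOn 𝓘(ℝ, ℝ) (𝓡 d) 2 q J → ∀ t ∈ J, ∀ w,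
      _ = S.eulerLagrange 1 0 q t w := fun hJT hq t ht w =>
    S.deriv_fderiv_chartLagrangian_sub hr (hJT ht) (hq.contMDiffAt (hJ.mem_nhds ht)) w
  constructor
  · rintro ⟨hJT, hq, h⟩
    exact ⟨fun s hs => by simpa using hJT hs, hq, fun s hs w =>
      (hEL hJT hq s hs w).symm.trans (sub_eq_zero.2 (h s hs w))⟩
  · rintro ⟨hJT, hq, h⟩
    have hJT' : J ⊆ S.T := fun s hs => by simpa using hJT s hs
    exact ⟨hJT', hq, fun s hs w => sub_eq_zero.1 ((hEL hJT' hq s hs w).trans (h s hs w))⟩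

theorem loweredAcceleration_metric {t : ℝ} (hr : 1 ≤ r) (ht : t ∈ S.T) (q : ℝ → Q) (s : ℝ) (w : 𝔼) :
    loweredAcceleration (S.a t) q s w = S.eulerLagrange 0 t q s w := by
  have hC := S.isC1At_fieldsInChart_self hr q ht s
  have hA : ∀ u v v', fderiv ℝ (fun x => chartComp (S.a t) (q s) x v v')
      (coordCurve (𝓡 d) q s s) u = fderiv ℝ (S.fieldsInChart (q s)).metric
        (t, coordCurve (𝓡 d) q s s) (0, u) v v' := fun u v v' => by
    have h := hasFDerivAt_clm_apply₂_const hC.differentiableAt_metric v v'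
    exact (fderiv_comp_prodMk_right h.differentiableAt u).trans
      (DFunLike.congr_fun h.fderiv (0, u))
  simp only [loweredAcceleration, christoffelFirst, hA, eulerLagrange,
    LagrangianFields.eulerLagrange, zero_mul, zero_add, hC.fderiv_lagrangian]
  have hmetric : ∀ x u v, (S.fieldsInChart (q s)).metric (t, x) u v =
      chartComp (S.a t) (q s) x u v := fun _ _ _ => rfl
  rw [hmetric]
  ring

theorem isGeodesicOn_metric_iff (hr : 1 ≤ r) {t : ℝ} (ht : t ∈ S.T) {q : ℝ → Q} {J : Set ℝ} :
    IsGeodesicOn (S.a t) q J ↔ S.IsReducedSolutionOn 0 t q J := by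
  simp only [isGeodesicOn_iff, S.loweredAcceleration_metric hr ht]
  exact ⟨fun h => ⟨fun s _ => by simpa using ht, h.1, h.2⟩, fun h => ⟨h.2, h.3⟩⟩

end ReducedEquation

section SpacetimeGeodesics

theorem contMDiffOn_spacetime_iff {γ : ℝ → S.Spacetime} {J : Set ℝ} :
    ContMDiffOn 𝓘(ℝ, ℝ) (spacetimeModel d) 2 γ J ↔
      ContDiffOn ℝ 2 (fun s => ((γ s).1 : ℝ)) J ∧
        ContMDiffOn 𝓘(ℝ, ℝ) (𝓡 d) 2 (fun s => (γ s).2.1) J ∧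
        ContDiffOn ℝ 2 (fun s => (γ s).2.2) J := by
  have h : ContDiffOn ℝ 2 (fun s => ((γ s).1 : ℝ)) J ↔
      ContMDiffOn 𝓘(ℝ, ℝ) 𝓘(ℝ, ℝ) 2 (fun s => (γ s).1) J := by
    rw [← contMDiffOn_iff_contDiffOn]
    exact forall₂_congr fun s _ => ChartedSpace.liftPropWithinAt_subtypeVal_comp_iff ..
  rw [contMDiffOn_prod_iff, contMDiffOn_prod_iff, h, ← contMDiffOn_iff_contDiffOn]
  rfl

variable {S} in
theorem contDiffAt_time {γ : ℝ → S.Spacetime} {s : ℝ}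
    (hγ : ContMDiffAt 𝓘(ℝ, ℝ) (spacetimeModel d) 2 γ s) :
    ContDiffAt ℝ 2 (fun s => ((γ s).1 : ℝ)) s :=
  (contMDiff_subtype_val.contMDiffAt.comp s hγ.fst).contDiffAt

variable [IsManifold (𝓡 d) 1 Q] {γ : ℝ → S.Spacetime} {s : ℝ}

theorem loweredAcceleration_eisenhartMetric (hr : 1 ≤ r)
    (hγ : ContMDiffAt 𝓘(ℝ, ℝ) (spacetimeModel d) 2 γ s) (w : ℝ × 𝔼 × ℝ) {t y : ℝ → ℝ} {x : ℝ → 𝔼}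
    (ht : t = fun s => ((γ s).1 : ℝ)) (hx : x = coordCurve (𝓡 d) (fun s => (γ s).2.1) s)
    (hy : y = fun s => (γ s).2.2) {F : LagrangianFields 𝔼} (hF : F = S.fieldsInChart (γ s).2.1) :
    loweredAcceleration S.eisenhartMetric γ s w =
      F.eulerLagrange (deriv t s) (t s, x s) (deriv x s) (deriv (deriv x) s) w.2.1
        + deriv (deriv t) s * (F.momentum w.1 (t s, x s) w.2.1 - w.2.2)
        + w.1 * (F.momentumRate (deriv t s) (t s, x s) (deriv x s) (deriv (deriv x) s)
          - F.timeForce (deriv t s) (t s, x s) (deriv x s) - deriv (deriv y) s) := by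
  have hmem := coordCurve_self_mem_target (I := spacetimeModel d) γ s
  have hcoord : coordCurve (spacetimeModel d) γ s = fun s => (t s, x s, y s) := by
    subst ht hx hy
    rfl
  have htC : ContDiffAt ℝ 2 t s := ht ▸ contDiffAt_time hγ
  have hxC : ContDiffAt ℝ 2 x s := hx ▸ contDiffAt_coordCurve hγ.snd.fst
  have hyC : ContDiffAt ℝ 2 y s := hy ▸ hγ.snd.snd.contDiffAt
  have hvelocity : deriv (coordCurve (spacetimeModel d) γ s) s =
      (deriv t s, deriv x s, deriv y s) := by
    rw [hcoord]
    exact (eventually_deriv_prodMk htC (hxC.prodMk hyC)).eq_of_nhds.trans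
      (congrArg (Prod.mk (deriv t s)) (eventually_deriv_prodMk hxC hyC).eq_of_nhds)
  have hacceleration : deriv (deriv (coordCurve (spacetimeModel d) γ s)) s =
      (deriv (deriv t) s, deriv (deriv x) s, deriv (deriv y) s) := by
    rw [hcoord, deriv_deriv_prodMk htC (hxC.prodMk hyC), deriv_deriv_prodMk hxC hyC]
  have hfderiv : ∀ u v, fderiv ℝ (fun z => chartComp S.eisenhartMetric (γ s) z u v)
      (coordCurve (spacetimeModel d) γ s s) =
      fderiv ℝ (fun z => F.brinkmann z u v) (coordCurve (spacetimeModel d) γ s s) := fun u v =>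
    (Filter.eventuallyEq_of_mem ((isOpen_extChartAt_target (γ s)).mem_nhds hmem)
      fun z hz => hF ▸ S.chartComp_eisenhartMetric hz u v).fderiv_eq
  have hmem' := S.mem_target_extChartAt_spacetime.1 hmem
  simp only [loweredAcceleration, christoffelFirst, hfderiv, S.chartComp_eisenhartMetric hmem,
    hvelocity, hacceleration, ← hF]
  simp only [hcoord] at hmem' ⊢
  have hF₁ : F.IsC1At (t s, x s) := hF ▸ S.isC1At_fieldsInChart hr hmem'.1 hmem'.2
  exact hF₁.brinkmann_add_christoffel (z := (t s, x s, y s)) _ _ _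

theorem loweredAcceleration_eisenhartMetric_of_time_eq (hr : 1 ≤ r)
    (hγ : ContMDiffAt 𝓘(ℝ, ℝ) (spacetimeModel d) 2 γ s) {k c : ℝ}
    (ht : (fun s => ((γ s).1 : ℝ)) =ᶠ[𝓝 s] fun s => k * s + c) {q : ℝ → Q}
    (hq : q = fun s => (γ s).2.1) {y : ℝ → ℝ} (hy : y = fun s => (γ s).2.2) (w : ℝ × 𝔼 × ℝ) :
    loweredAcceleration S.eisenhartMetric γ s w = S.eulerLagrange k c q s w.2.1
      + w.1 * (deriv (S.momentum k c q) s - S.timeForce k c q s - deriv (deriv y) s) := by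
  subst hq hy
  have hT : k * s + c ∈ S.T := ht.eq_of_nhds ▸ (γ s).1.2
  have ht' : deriv (fun s => ((γ s).1 : ℝ)) =ᶠ[𝓝 s] fun _ => k :=
    ht.deriv.trans (.of_forall fun s => (hasDerivAt_mul_add_const k c s).deriv)
  rw [S.loweredAcceleration_eisenhartMetric hr hγ w rfl rfl rfl rfl, ht'.deriv_eq,
    ht'.eq_of_nhds, ht.eq_of_nhds, deriv_const, zero_mul, add_zero,
    (S.hasDerivAt_momentum hr hγ.snd.fst hT).deriv,
    (S.eventually_timeForce_eq hr hγ.snd.fst hT).eq_of_nhds]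
  rfl

variable {J : Set ℝ}

theorem exists_time_eq_mul_add_const (hr : 1 ≤ r) (hJ : IsOpen J) (hJc : J.OrdConnected)
    {s₀ : ℝ} (hs₀ : s₀ ∈ J) (h : IsGeodesicOn S.eisenhartMetric γ J) :
    ∃ k c : ℝ, EqOn (fun s => ((γ s).1 : ℝ)) (fun s => k * s + c) J := by
  refine exists_eqOn_mul_add_const hJ hJc hs₀ (S.contMDiffOn_spacetime_iff.1 h.1).1 fun s hs => ?_
  -- The `y`-component of the geodesic equation.
  have hy := isGeodesicOn_iff.1 h |>.2 s hs (0, 0, 1)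
  rw [S.loweredAcceleration_eisenhartMetric hr (h.contMDiffAt hJ hs) _ rfl rfl rfl rfl] at hy
  simpa [LagrangianFields.eulerLagrange, LagrangianFields.momentum, Prod.mk_zero_zero] using hy

theorem isGeodesicOn_eisenhartMetric_iff (hr : 1 ≤ r) (hJ : IsOpen J) {k c : ℝ}
    (ht : EqOn (fun s => ((γ s).1 : ℝ)) (fun s => k * s + c) J) {q : ℝ → Q}
    (hq : q = fun s => (γ s).2.1) {y : ℝ → ℝ} (hy : y = fun s => (γ s).2.2) :
    IsGeodesicOn S.eisenhartMetric γ J ↔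
      S.IsReducedSolutionOn k c q J ∧ ContDiffOn ℝ 2 y J ∧
        EqOn (deriv (deriv y)) (fun s => deriv (S.momentum k c q) s - S.timeForce k c q s) J := by
  have hT : ∀ s ∈ J, k * s + c ∈ S.T := fun s hs => mem_of_eq_of_mem (ht hs).symm (γ s).1.2
  have hacc : ContMDiffOn 𝓘(ℝ, ℝ) (spacetimeModel d) 2 γ J → ∀ s ∈ J, ∀ w,
      loweredAcceleration S.eisenhartMetric γ s w = S.eulerLagrange k c q s w.2.1
        + w.1 * (deriv (S.momentum k c q) s - S.timeForce k c q s - deriv (deriv y) s) :=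
    fun hγ s hs w => S.loweredAcceleration_eisenhartMetric_of_time_eq hr
      (hγ.contMDiffAt (hJ.mem_nhds hs)) (ht.eventuallyEq_of_mem (hJ.mem_nhds hs)) hq hy w
  rw [isGeodesicOn_iff]
  constructor
  · rintro ⟨hγ, h⟩
    obtain ⟨-, hqC, hyC⟩ := S.contMDiffOn_spacetime_iff.1 hγ
    rw [← hq] at hqC
    rw [← hy] at hyC
    have h' := fun s hs w => (hacc hγ s hs w).symm.trans (h s hs w)
    have hx : ∀ s ∈ J, ∀ w, S.eulerLagrange k c q s w = 0 := fun s hs w => by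
      simpa using h' s hs (0, w, 0)
    refine ⟨⟨hT, hqC, hx⟩, hyC, fun s hs => ?_⟩
    have hs' := h' s hs (1, 0, 0)
    rw [hx s hs, zero_add, one_mul] at hs'
    exact (sub_eq_zero.1 hs').symm
  · rintro ⟨⟨-, hqC, hx⟩, hyC, hy''⟩
    have hγ : ContMDiffOn 𝓘(ℝ, ℝ) (spacetimeModel d) 2 γ J :=
      S.contMDiffOn_spacetime_iff.2 ⟨ContDiffOn.congr (by fun_prop) ht, hq ▸ hqC, hy ▸ hyC⟩
    refine ⟨hγ, fun s hs w => (hacc hγ s hs w).trans ?_⟩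
    rw [hx s hs, hy'' hs, sub_self, mul_zero, add_zero]

end SpacetimeGeodesics

section ReducedSolutions

variable {S} {k c : ℝ} {q : ℝ → Q} {J : Set ℝ}

theorem IsReducedSolutionOn.comp_mul_add_const (h : S.IsReducedSolutionOn k c q J) (m n : ℝ) :
    S.IsReducedSolutionOn (k * m) (k * n + c) (fun s => q (m * s + n))
      ((fun s => m * s + n) ⁻¹' J) := by
  have htime : ∀ s, k * m * s + (k * n + c) = k * (m * s + n) + c := fun s => by ring
  refine ⟨fun s hs => htime s ▸ h.time_mem _ hs, ?_, fun s hs w => ?_⟩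
  · have haffine : ContMDiff 𝓘(ℝ, ℝ) 𝓘(ℝ, ℝ) 2 fun s : ℝ => m * s + n :=
      ContDiff.contMDiff (by fun_prop)
    exact h.contMDiffOn.comp haffine.contMDiffOn fun s hs => hs
  · have hcoord : coordCurve (𝓡 d) (fun s => q (m * s + n)) s =
      fun u => coordCurve (𝓡 d) q (m * s + n) (m * u + n) := rfl
    rw [eulerLagrange, hcoord, deriv_comp_mul_add_const, deriv_fun_const_smul_field,
      deriv_comp_mul_add_const, htime, LagrangianFields.eulerLagrange_smul]
    exact mul_eq_zero_of_right _ (h.eulerLagrange_eq_zero _ hs w)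

theorem isReducedSolutionOn_const (hc : c ∈ S.T) (q₀ : Q) (J : Set ℝ) :
    S.IsReducedSolutionOn 0 c (fun _ => q₀) J := by
  refine ⟨fun s _ => by simpa using hc, contMDiffOn_const, fun s _ w => ?_⟩
  have hcoord : coordCurve (𝓡 d) (fun _ : ℝ => q₀) s = fun _ => extChartAt (𝓡 d) q₀ q₀ := rfl
  rw [eulerLagrange, hcoord, deriv_const', deriv_const]
  exact LagrangianFields.eulerLagrange_zero _ _ w

theorem ELFlowComplete.exists_isReducedSolutionOn_univ [IsManifold (𝓡 d) 1 Q] (hr : 1 ≤ r)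
    (hS : S.ELFlowComplete) (hJ : IsOpen J) (hJc : J.OrdConnected) (hne : J.Nonempty)
    (hk : k ≠ 0) (h : S.IsReducedSolutionOn k c q J) :
    ∃ q' : ℝ → Q, S.IsReducedSolutionOn k c q' univ ∧ EqOn q' q J := by
  have hinv : ∀ s, k⁻¹ * (k * s + c) + -(k⁻¹ * c) = s := fun s => by field_simp; ring
  have hreparam := h.comp_mul_add_const k⁻¹ (-(k⁻¹ * c))
  rw [mul_inv_cancel₀ hk, show k * -(k⁻¹ * c) + c = 0 by field_simp; ring] at hreparam
  have hopen : IsOpen ((fun s => k⁻¹ * s + -(k⁻¹ * c)) ⁻¹' J) := hJ.preimage (by fun_prop)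
  have hmem : ∀ s ∈ J, k * s + c ∈ (fun s => k⁻¹ * s + -(k⁻¹ * c)) ⁻¹' J := fun s hs => by
    rwa [mem_preimage, hinv]
  obtain ⟨q', hq', heq⟩ := hS _ _ hopen (ordConnected_preimage_mul_add_const hJc _ _)
    ⟨_, hmem _ hne.some_mem⟩ ((S.isELSolutionOn_iff hr hopen).2 hreparam)
  have hback := ((S.isELSolutionOn_iff hr isOpen_univ).1 hq').comp_mul_add_const k c
  rw [one_mul, one_mul, add_zero, preimage_univ] at hback
  exact ⟨_, hback, fun s hs => (heq (hmem s hs)).trans (congrArg q (hinv s))⟩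

end ReducedSolutions

section Lift

variable [IsManifold (𝓡 d) 1 Q] {J : Set ℝ} {s₀ k c : ℝ}

theorem exists_geodesic_lift (hr : 1 ≤ r) (hJ : IsOpen J) (hJc : J.OrdConnected) (hs₀ : s₀ ∈ J)
    {q : ℝ → Q} (h : S.IsReducedSolutionOn k c q J) (y₀ y₁ : ℝ) :
    ∃ γ : ℝ → S.Spacetime, IsGeodesicOn S.eisenhartMetric γ J ∧
      EqOn (fun s => ((γ s).1 : ℝ)) (fun s => k * s + c) J ∧ q = (fun s => (γ s).2.1) ∧
      (γ s₀).2.2 = y₀ ∧ deriv (fun s => (γ s).2.2) s₀ = y₁ := by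
  classical
  have hq : ∀ s ∈ J, ContMDiffAt 𝓘(ℝ, ℝ) (𝓡 d) 2 q s := fun s hs =>
    h.contMDiffOn.contMDiffAt (hJ.mem_nhds hs)
  have hcont : ContinuousOn (fun s => deriv (S.momentum k c q) s - S.timeForce k c q s) J :=
    fun s hs =>
      have hmomentum : ContDiffAt ℝ 0 (deriv (S.momentum k c q)) s :=
        (S.contDiffAt_momentum hr (hq s hs) (h.time_mem s hs)).derivWithin (by norm_num)
      (hmomentum.continuousAt.sub
        (S.continuousAt_timeForce hr (hq s hs) (h.time_mem s hs))).continuousWithinAt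
  obtain ⟨y, hyC, hy'', hy₀, hy₁⟩ := exists_deriv_deriv_eq hJ hJc hs₀ hcont y₀ y₁
  let γ : ℝ → S.Spacetime := fun s =>
    (if hs : k * s + c ∈ S.T then ⟨k * s + c, hs⟩ else ⟨k * s₀ + c, h.time_mem s₀ hs₀⟩, q s, y s)
  have ht : EqOn (fun s => ((γ s).1 : ℝ)) (fun s => k * s + c) J := fun s hs => by
    simp [γ, h.time_mem s hs]
  exact ⟨γ, (S.isGeodesicOn_eisenhartMetric_iff hr hJ ht rfl rfl).2 ⟨h, hyC, hy''⟩, ht, rfl,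
    hy₀, hy₁⟩

theorem exists_geodesic_extension (hr : 1 ≤ r) (hJ : IsOpen J) (hJc : J.OrdConnected)
    (hs₀ : s₀ ∈ J) {γ : ℝ → S.Spacetime} (hγ : IsGeodesicOn S.eisenhartMetric γ J)
    (ht : EqOn (fun s => ((γ s).1 : ℝ)) (fun s => k * s + c) J) {q : ℝ → Q}
    (h : S.IsReducedSolutionOn k c q univ) (hq : EqOn q (fun s => (γ s).2.1) J) :
    ∃ γ' : ℝ → S.Spacetime, IsGeodesicOn S.eisenhartMetric γ' univ ∧ EqOn γ' γ J := by
  obtain ⟨γ', hγ', ht', rfl, hy₀, hy₁⟩ := S.exists_geodesic_lift hr isOpen_univ ordConnected_univ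
    (mem_univ s₀) h (γ s₀).2.2 (deriv (fun s => (γ s).2.2) s₀)
  obtain ⟨-, hyC, hacc⟩ := (S.isGeodesicOn_eisenhartMetric_iff hr hJ ht rfl rfl).1 hγ
  obtain ⟨-, hyC', hacc'⟩ :=
    (S.isGeodesicOn_eisenhartMetric_iff hr isOpen_univ ht' rfl rfl).1 hγ'
  have hq' : ∀ s ∈ J, (fun s => (γ' s).2.1) =ᶠ[𝓝 s] fun s => (γ s).2.1 := fun s hs =>
    hq.eventuallyEq_of_mem (hJ.mem_nhds hs)
  have hmomentum : EqOn (S.momentum k c fun s => (γ' s).2.1)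
      (S.momentum k c fun s => (γ s).2.1) J := fun s hs => S.momentum_congr k c (hq' s hs)
  have heq : EqOn (fun s => (γ' s).2.2) (fun s => (γ s).2.2) J := by
    refine eqOn_of_deriv_deriv_eq hJ hJc hs₀ (hyC'.mono (subset_univ J)) hyC (fun s hs => ?_)
      hy₀ hy₁
    exact (hacc' (mem_univ s)).trans (.trans (congrArg₂ (· - ·)
      (hmomentum.eventuallyEq_of_mem (hJ.mem_nhds hs)).deriv_eq
      (S.timeForce_congr k c (hq' s hs))) (hacc hs).symm)
  exact ⟨γ', hγ', fun s hs => Prod.ext (Subtype.ext ((ht' (mem_univ s)).trans (ht hs).symm))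
    (Prod.ext (hq hs) (heq hs))⟩

theorem isReducedSolutionOn_univ_of_eqOn (hr : 1 ≤ r) (hJ : IsOpen J) (hs₀ : s₀ ∈ J)
    {γ γ' : ℝ → S.Spacetime} (ht : EqOn (fun s => ((γ s).1 : ℝ)) (fun s => k * s + c) J)
    (hγ' : IsGeodesicOn S.eisenhartMetric γ' univ) (h : EqOn γ' γ J) :
    S.IsReducedSolutionOn k c (fun s => (γ' s).2.1) univ := by
  obtain ⟨k', c', ht'⟩ :=
    S.exists_time_eq_mul_add_const hr isOpen_univ ordConnected_univ (mem_univ s₀) hγ'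
  obtain ⟨rfl, rfl⟩ := coeff_eq_of_eqOn_mul_add_const hJ hs₀ fun s hs =>
    (ht' (mem_univ s)).symm.trans ((congrArg (fun x => (x.1 : ℝ)) (h hs)).trans (ht hs))
  exact ((S.isGeodesicOn_eisenhartMetric_iff hr isOpen_univ ht' rfl rfl).1 hγ').1

end Lift

section Completeness

variable {S} {J : Set ℝ} {γ : ℝ → S.Spacetime} {k c s : ℝ}

theorem dt_velocity_of_time_eq (hγ : MDifferentiableAt 𝓘(ℝ, ℝ) (spacetimeModel d) γ s)
    (ht : (fun s => ((γ s).1 : ℝ)) =ᶠ[𝓝 s] fun s => k * s + c) :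
    S.dt (γ s) (velocity (spacetimeModel d) γ s) = k := by
  rw [S.dt_velocity hγ, ht.deriv_eq, (hasDerivAt_mul_add_const k c s).deriv]

theorem eisenhartMetric_velocity (hγ : MDifferentiableAt 𝓘(ℝ, ℝ) (spacetimeModel d) γ s)
    (ht : (fun s => ((γ s).1 : ℝ)) =ᶠ[𝓝 s] fun s => k * s + c) :
    S.eisenhartMetric (γ s) (velocity (spacetimeModel d) γ s) (velocity (spacetimeModel d) γ s) =
      2 * (S.scaledLagrangian k (k * s + c) (γ s).2.1 (velocity (𝓡 d) (fun s => (γ s).2.1) s)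
        - k * deriv (fun s => (γ s).2.2) s) := by
  simp only [eisenhartMetric, LinearMap.mk₂_apply, dyb, sub_apply, ContinuousLinearMap.comp_apply,
    scaledLagrangian]
  rw [dt_velocity_of_time_eq hγ ht, S.dy_velocity hγ, S.dq_velocity hγ, ht.eq_of_nhds]
  ring

variable [IsManifold (𝓡 d) 1 Q]

theorem ELFlowComplete.exists_geodesic_extension (hr : 1 ≤ r) (hS : S.ELFlowComplete)
    (hJ : IsOpen J) (hJc : J.OrdConnected) (hne : J.Nonempty)
    (hγ : IsGeodesicOn S.eisenhartMetric γ J)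
    (hconst : ∀ c ∈ S.T, EqOn (fun s => ((γ s).1 : ℝ)) (fun _ => c) J →
      S.IsReducedSolutionOn 0 c (fun s => (γ s).2.1) J →
      ∃ q : ℝ → Q, S.IsReducedSolutionOn 0 c q univ ∧ EqOn q (fun s => (γ s).2.1) J) :
    ∃ γ' : ℝ → S.Spacetime, IsGeodesicOn S.eisenhartMetric γ' univ ∧ EqOn γ' γ J := by
  obtain ⟨s₀, hs₀⟩ := hne
  obtain ⟨k, c, ht⟩ := S.exists_time_eq_mul_add_const hr hJ hJc hs₀ hγ
  have h := ((S.isGeodesicOn_eisenhartMetric_iff hr hJ ht rfl rfl).1 hγ).1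
  obtain ⟨q, hq, heq⟩ : ∃ q : ℝ → Q, S.IsReducedSolutionOn k c q univ ∧
      EqOn q (fun s => (γ s).2.1) J := by
    rcases eq_or_ne k 0 with rfl | hk
    · exact hconst c (by simpa using h.time_mem s₀ hs₀) (by simpa using ht) h
    · exact hS.exists_isReducedSolutionOn_univ hr hJ hJc ⟨s₀, hs₀⟩ hk h
  exact S.exists_geodesic_extension hr hJ hJc hs₀ hγ ht hq heq

theorem ELFlowComplete.causallyGeodesicallyComplete (hr : 1 ≤ r) (hS : S.ELFlowComplete) :
    CausallyGeodesicallyComplete S.eisenhartMetric := by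
  rintro J γ hJ hJc ⟨s₀, hs₀⟩ hγ hcausal
  refine hS.exists_geodesic_extension hr hJ hJc ⟨s₀, hs₀⟩ hγ fun c hc ht h => ?_
  have hvelocity : ∀ s ∈ J, velocity (𝓡 d) (fun s => (γ s).2.1) s = 0 := fun s hs => by
    by_contra hne
    have hle := (hcausal s hs).2
    rw [eisenhartMetric_velocity (k := 0) (c := c) ((hγ.contMDiffAt hJ hs).mdifferentiableAt
      two_ne_zero) (by simpa using ht.eventuallyEq_of_mem (hJ.mem_nhds hs))] at hle
    have hpos := S.a_pos c hc _ _ hne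
    simp only [scaledLagrangian, zero_mul, zero_add] at hle
    linarith
  exact ⟨_, isReducedSolutionOn_const hc (γ s₀).2.1 univ,
    eqOn_const_of_velocity_eq_zero hJ hJc h.contMDiffOn hvelocity hs₀⟩

theorem ELFlowComplete.geodesicallyComplete (hr : 1 ≤ r) (hS : S.ELFlowComplete)
    (hQ : ∀ t ∈ S.T, GeodesicallyComplete (S.a t)) : GeodesicallyComplete S.eisenhartMetric := by
  intro J γ hJ hJc hne hγ
  refine hS.exists_geodesic_extension hr hJ hJc hne hγ fun c hc _ h => ?_
  simp only [← S.isGeodesicOn_metric_iff hr hc] at h ⊢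
  exact hQ c hc J _ hJ hJc hne h

theorem isNullOn_of_scaledLagrangian_eq (hr : 1 ≤ r) (hJ : IsOpen J) (hJc : J.OrdConnected)
    (hγ : IsGeodesicOn S.eisenhartMetric γ J) (hk : k ≠ 0)
    (ht : EqOn (fun s => ((γ s).1 : ℝ)) (fun s => k * s + c) J) (hs : s ∈ J)
    (hy : k * deriv (fun s => (γ s).2.2) s = S.scaledLagrangian k (k * s + c) (γ s).2.1
      (velocity (𝓡 d) (fun s => (γ s).2.1) s)) :
    IsNullOn S.eisenhartMetric γ J := by
  have hγ' : ∀ u ∈ J, MDifferentiableAt 𝓘(ℝ, ℝ) (spacetimeModel d) γ u := fun u hu =>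
    (hγ.contMDiffAt hJ hu).mdifferentiableAt two_ne_zero
  have ht' : ∀ u ∈ J, (fun s => ((γ s).1 : ℝ)) =ᶠ[𝓝 u] fun s => k * s + c := fun u hu =>
    ht.eventuallyEq_of_mem (hJ.mem_nhds hu)
  refine fun u hu => ⟨fun hzero => hk ?_, ?_⟩
  · rw [← dt_velocity_of_time_eq (hγ' u hu) (ht' u hu), hzero, map_zero]
  · rw [hγ.apply_velocity_eq S.eisenhartMetric_symm (S.contDiffOn_chartComp_eisenhartMetric hr)
      hJ hJc hs hu, eisenhartMetric_velocity (hγ' s hs) (ht' s hs), hy, sub_self, mul_zero]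

theorem elFlowComplete_of_nullGeodesicallyComplete (hr : 1 ≤ r)
    (h : NullGeodesicallyComplete S.eisenhartMetric) : S.ELFlowComplete := by
  rintro J q hJ hJc ⟨s₀, hs₀⟩ hq
  rw [S.isELSolutionOn_iff hr hJ] at hq
  obtain ⟨γ, hγ, ht, rfl, -, hy₁⟩ := S.exists_geodesic_lift hr hJ hJc hs₀ hq 0
    (S.scaledLagrangian 1 (1 * s₀ + 0) (q s₀) (velocity (𝓡 d) q s₀))
  have hnull := isNullOn_of_scaledLagrangian_eq hr hJ hJc hγ one_ne_zero ht hs₀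
    ((one_mul _).trans hy₁)
  obtain ⟨γ', hγ', heq⟩ := h J γ hJ hJc ⟨s₀, hs₀⟩ hγ hnull
  exact ⟨fun s => (γ' s).2.1, (S.isELSolutionOn_iff hr isOpen_univ).2
    (S.isReducedSolutionOn_univ_of_eqOn hr hJ hs₀ ht hγ' heq),
    fun s hs => congrArg (fun x => x.2.1) (heq hs)⟩

theorem geodesicallyComplete_metric (hr : 1 ≤ r) (h : GeodesicallyComplete S.eisenhartMetric)
    {t : ℝ} (ht : t ∈ S.T) : GeodesicallyComplete (S.a t) := by
  rintro J q hJ hJc ⟨s₀, hs₀⟩ hq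
  obtain ⟨γ, hγ, htime, rfl, -⟩ := S.exists_geodesic_lift hr hJ hJc hs₀
    ((S.isGeodesicOn_metric_iff hr ht).1 hq) 0 0
  obtain ⟨γ', hγ', heq⟩ := h J γ hJ hJc ⟨s₀, hs₀⟩ hγ
  exact ⟨fun s => (γ' s).2.1, (S.isGeodesicOn_metric_iff hr ht).2
    (S.isReducedSolutionOn_univ_of_eqOn hr hJ hs₀ htime hγ' heq),
    fun s hs => congrArg (fun x => x.2.1) (heq hs)⟩

end Completeness

end MechanicalSystem

end

theorem theorem5p3_general {d : ℕ} {Q : Type*} [TopologicalSpace Q]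
    [ChartedSpace (EuclideanSpace ℝ (Fin d)) Q] {r : WithTop ℕ∞} (hr : 1 ≤ r)
    [IsManifold (𝓡 d) 1 Q] (S : MechanicalSystem d Q r) :
    (S.ELFlowComplete ↔ NullGeodesicallyComplete S.eisenhartMetric) ∧
    (S.ELFlowComplete → CausallyGeodesicallyComplete S.eisenhartMetric) ∧
    ((S.ELFlowComplete ∧ ∀ t ∈ S.T, GeodesicallyComplete (S.a t)) ↔
      GeodesicallyComplete S.eisenhartMetric) := by
  have hcausal : S.ELFlowComplete → CausallyGeodesicallyComplete S.eisenhartMetric := fun h =>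
    h.causallyGeodesicallyComplete hr
  have hnull : NullGeodesicallyComplete S.eisenhartMetric → S.ELFlowComplete :=
    MechanicalSystem.elFlowComplete_of_nullGeodesicallyComplete hr
  refine ⟨⟨fun h => (hcausal h).nullGeodesicallyComplete, hnull⟩, hcausal, ?_, ?_⟩
  · rintro ⟨hflow, hQ⟩
    exact hflow.geodesicallyComplete hr hQ
  · exact fun h => ⟨hnull h.nullGeodesicallyComplete,
      fun t ht => MechanicalSystem.geodesicallyComplete_metric hr h ht⟩

theorem theorem5p3 {d : ℕ} {Q : Type*} [TopologicalSpace Q]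
    [ChartedSpace (EuclideanSpace ℝ (Fin d)) Q] [T2Space Q] [ParacompactSpace Q]
    [ConnectedSpace Q] {r : WithTop ℕ∞} (hr : 2 ≤ r) [IsManifold (𝓡 d) (r + 1) Q]
    (S : MechanicalSystem d Q r) :
    (S.ELFlowComplete ↔ NullGeodesicallyComplete S.eisenhartMetric) ∧
    (S.ELFlowComplete → CausallyGeodesicallyComplete S.eisenhartMetric) ∧
    ((S.ELFlowComplete ∧ ∀ t ∈ S.T, GeodesicallyComplete (S.a t)) ↔
      GeodesicallyComplete S.eisenhartMetric) :=
  have : IsManifold (𝓡 d) 1 Q := IsManifold.of_le (n := r + 1) le_add_self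
  theorem5p3_general (one_le_two.trans hr) S
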